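/- **Framework.** Let $n\in\mathbb N$ and let $X=(X_1,\dots,X_n)$ have law $\mathbf P^\star=\bigotimes_{i=1}^n P_i^\star$ on $\prod_i\mathscr X_i$, the $P^\star_i$ being arbitrary probabilities. Let $\mu_i$ be a $\sigma$-finite measure on $\mathscr X_i$ and $\boldsymbol\mu=\bigotimes_i\mu_i$. For a countable set $\mathcal M$ and each $m\in\mathcal M$, let $\mathcal Q_m$ be a set of product densities $\mathbf q=(q_1,\dots,q_n)$ with respect to $\boldsymbol\mu$ (finite-valued versions), $\mathscr P_m=\{\mathbf q\cdot\boldsymbol\mu:\mathbf q\in\mathcal Q_m\}$, $\mathcal Q=\bigcup_m\mathcal Q_m$, $\mathscr P=\bigcup_m\mathscr P_m$; write $\mathbf Q=\mathbf q\cdot\boldsymbol\mu=\bigotimes_iQ_i$. Let $\Delta:\mathcal M\to\mathbb R$ satisfy $\sum_m e^{-\Delta(m)}=1$. Put $h^2(P,Q)=\frac12\int(\sqrt{dP/d\nu}-\sqrt{dQ/d\nu})^2d\nu$ ($\nu$ dominating $P$ and $Q$) and $H^2(\mathbf P,\mathbf Q)=\sum_{i=1}^n h^2(P_i,Q_i)$.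 **The function $\psi$.** Let $a_0\ge1\ge a_1>0$ and $a_2^2\ge 1\vee(6a_1)$, and let $\psi:[0,+\infty]\to\mathbb R$ be continuous and strictly increasing with $\psi(1/x)=-\psi(x)$ and $\psi(0)=-1$. Assume that for all $\mathbf q,\mathbf q'\in\mathcal Q$, $\mathbf R\in\mathscr P$ and $i$, $$\int\psi\Big(\sqrt{q_i'/q_i}\Big)dR_i\le a_0h^2(R_i,Q_i)-a_1h^2(R_i,Q_i'),\qquad \int\psi^2\Big(\sqrt{q_i'/q_i}\Big)dR_i\le a_2^2\big[h^2(R_i,Q_i)+h^2(R_i,Q_i')\big],$$ with $0/0=1$ and $a/0=+\infty$ for $a>0$. Put $\mathbf T(x,\mathbf q,\mathbf q')=\sum_i\psi\big(\sqrt{q'_i(x_i)/q_i(x_i)}\big)$ and $\mathbf Z(x,\mathbf q,\mathbf q')=\mathbf T(x,\mathbf q,\mathbf q')-\mathbb E_{\mathbf P^\star}[\mathbf T(X,\mathbf q,\mathbf q')]$. **Dimension.** For $\overline{\mathbf P}=\overline{\mathbf p}\cdot\boldsymbol\mu\in\mathscr P$ and $z>0$ let $$w_m(z)=\mathbb E_{\mathbf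 P^\star}\Big[\sup\{|\mathbf Z(X,\overline{\mathbf p},\mathbf q)|:\mathbf q\in\mathcal Q_m,\ H^2(\mathbf P^\star,\overline{\mathbf P})+H^2(\mathbf P^\star,\mathbf Q)<z\}\Big]\quad(\sup\varnothing=0),$$ $$D_n^{\mathscr P_m}(\mathbf P^\star,\overline{\mathbf P})=1\vee\Big[\Big(\frac{a_1}{4a_2}\Big)^2\sup\big\{z>0: w_m(z)>\tfrac{a_1}{8}z\big\}\Big].$$ As measurability convention, for each $m$ and each $\overline{\mathbf p}\in\mathcal Q$ the process $\mathbf q\mapsto\mathbf Z(X,\overline{\mathbf p},\mathbf q)$ on $\mathcal Q_m$ is assumed separable for $H$ under $\mathbf P^\star$: there is a countable $S\subset\mathcal Q_m$ such that for $\mathbf P^\star$-almost every $x$, every $\mathbf q\in\mathcal Q_m$ and every $\varepsilon>0$ some $\mathbf s\in S$ satisfies $H^2(\mathbf s\cdot\boldsymbol\mu,\mathbf q\cdot\boldsymbol\mu)<\varepsilon$ and $|\mathbf Z(x,\overline{\mathbf p},\mathbf s)-\mathbf Z(x,\overline{\mathbf p},\mathbf q)|<\varepsilon$ (automatic for countable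 $\mathcal Q_m$). "With probability at least $p$" means that the property holds on a measurable set of probability at least $p$. **Estimator.** Given $\mathrm{pen}:\mathscr P\to[0,+\infty)$, let $\boldsymbol\Upsilon(x,\mathbf q)=\sup_{\mathbf q'\in\mathcal Q}[\mathbf T(x,\mathbf q,\mathbf q')-\mathrm{pen}(\mathbf Q')]+\mathrm{pen}(\mathbf Q)$, and let $\widehat{\mathbf P}=\widehat{\mathbf p}\cdot\boldsymbol\mu$ where $\widehat{\mathbf p}=\widehat{\mathbf p}(x)$ is any minimiser of $\boldsymbol\Upsilon(x,\cdot)$ over $\mathcal Q$ (assumed to exist for every $x$). **Theorem.** There are constants $\kappa>0$ and $\overline C\ge1$, depending only on $a_0,a_1,a_2$, such that in every framework as above the following holds. 1. Let $G(\mathbf P^\star,\cdot)$ be a real function on $\mathscr P$ such that for all $\overline{\mathbf P}\in\mathscr P$, $m\in\mathcal M$ and $\mathbf Q\in\mathscr P_m$, $$G(\mathbf P^\star,\overline{\mathbf P})+\mathrm{pen}(\mathbf Q)\ge\kappa\big[D_n^{\mathscr P_m}(\mathbf P^\star,\overline{\mathbf P})+\Delta(m)\big].$$ Then for every $\overline{\mathbf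 P}\in\mathscr P$ and every $\xi\ge0$, $$\mathbb P_{\mathbf P^\star}\Big[H^2(\mathbf P^\star,\widehat{\mathbf P})\le\overline C\big[H^2(\mathbf P^\star,\overline{\mathbf P})+G(\mathbf P^\star,\overline{\mathbf P})+\mathrm{pen}(\overline{\mathbf P})+\xi\big]\Big]\ge1-e^{-\xi}.$$ 2. (Oracle inequality.) If numbers $D_n(\mathscr P_m)$ satisfy $D_n^{\mathscr P_m}(\mathbf P^\star,\overline{\mathbf P})\le D_n(\mathscr P_m)$ for all $m$ and all $\overline{\mathbf P}\in\mathscr P$, and $\mathrm{pen}(\mathbf Q)=\kappa[D_n(\mathscr P_m)+\Delta(m)]$ for all $m$ and $\mathbf Q\in\mathscr P_m$, then for every $\xi\ge0$, with probability at least $1-e^{-\xi}$, $$H^2(\mathbf P^\star,\widehat{\mathbf P})\le\overline C\inf_{m\in\mathcal M}\Big[\inf_{\mathbf Q\in\mathscr P_m}H^2(\mathbf P^\star,\mathbf Q)+D_n(\mathscr P_m)+\Delta(m)+\xi\Big],$$ and $H^2(\mathbf P^\star,\widehat{\mathbf P})$ is bounded by a measurable integrable function of $X$ whose expectation is at most $\overline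 C\inf_{m}\big[\inf_{\mathbf Q\in\mathscr P_m}H^2(\mathbf P^\star,\mathbf Q)+D_n(\mathscr P_m)+\Delta(m)\big]$. (Infima over empty sets are $+\infty$.) -/

import Mathlib

open MeasureTheory
open scoped NNReal ENNReal

namespace RhoEst

noncomputable section

universe u

/-- The squared Hellinger distance `h²(P, Q) = (1/2) ∫ (√(dP/dν) - √(dQ/dν))² dν`, computed with the
dominating measure `ν = P + Q` (for probability measures the value does not depend on `ν`). -/
def hellingerSq {Ω : Type u} [MeasurableSpace Ω] (P Q : Measure Ω) : ℝ :=
  (1 / 2) * ∫ x, (√((P.rnDeriv (P + Q) x).toReal) - √((Q.rnDeriv (P + Q) x).toReal)) ^ 2 ∂(P + Q)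

/-- The ratio `a / b`, with the conventions `0 / 0 = 1` and `a / 0 = +∞` for `a > 0`. -/
def ratio (a b : ℝ≥0) : ℝ≥0∞ :=
  if a = 0 ∧ b = 0 then 1 else (a : ℝ≥0∞) / (b : ℝ≥0∞)

/-- `ψ : [0, +∞] → ℝ` is continuous, strictly increasing, with `ψ (1 / x) = - ψ x` and
`ψ 0 = -1` (hence `ψ 1 = 0` and `ψ (+∞) = 1`). -/
structure IsRhoFunction (ψ : ℝ≥0∞ → ℝ) : Prop where
  continuous : Continuous ψ
  strictMono : StrictMono ψ
  map_inv : ∀ x, ψ x⁻¹ = - ψ x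
  map_zero : ψ 0 = -1

variable {n : ℕ} {𝒳 : Fin n → Type u} [∀ i, MeasurableSpace (𝒳 i)]

/-- `q = (q₁, …, qₙ)` where each `qᵢ` is a probability density with respect to `μᵢ`. -/
def IsProductDensity (μ : ∀ i, Measure (𝒳 i)) (q : ∀ i, 𝒳 i → ℝ≥0) : Prop :=
  ∀ i, Measurable (q i) ∧ IsProbabilityMeasure ((μ i).withDensity fun x => (q i x : ℝ≥0∞))

/-- The law `q · μ = ⨂ᵢ (qᵢ · μᵢ)`. A product probability is given by the family of its
marginals. -/
def law (μ : ∀ i, Measure (𝒳 i)) (q : ∀ i, 𝒳 i → ℝ≥0) : ∀ i, Measure (𝒳 i) :=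
  fun i => (μ i).withDensity fun x => (q i x : ℝ≥0∞)

/-- `H²(P, Q) = ∑ᵢ h²(Pᵢ, Qᵢ)` for the product laws with marginals `Pᵢ` and `Qᵢ`. -/
def lossSq (P Q : ∀ i, Measure (𝒳 i)) : ℝ :=
  ∑ i, hellingerSq (P i) (Q i)

/-- `ψ(√(q'ᵢ(x) / qᵢ(x)))`. -/
def psiRatio (ψ : ℝ≥0∞ → ℝ) (q q' : ∀ i, 𝒳 i → ℝ≥0) (i : Fin n) (x : 𝒳 i) : ℝ :=
  ψ (ratio (q' i x) (q i x) ^ (1 / 2 : ℝ))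

/-- The two integral inequalities that link `ψ`, on the set `𝒬` of densities, to the Hellinger
distance: for all `q, q' ∈ 𝒬`, every `R = r · μ` with `r ∈ 𝒬` and every `i`. -/
structure SatisfiesMoments (a₀ a₁ a₂ : ℝ) (ψ : ℝ≥0∞ → ℝ) (μ : ∀ i, Measure (𝒳 i))
    (𝒬 : Set (∀ i, 𝒳 i → ℝ≥0)) : Prop where
  mean : ∀ q ∈ 𝒬, ∀ q' ∈ 𝒬, ∀ r ∈ 𝒬, ∀ i,
    ∫ x, psiRatio ψ q q' i x ∂(law μ r i) ≤
      a₀ * hellingerSq (law μ r i) (law μ q i) - a₁ * hellingerSq (law μ r i) (law μ q' i)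
  square : ∀ q ∈ 𝒬, ∀ q' ∈ 𝒬, ∀ r ∈ 𝒬, ∀ i,
    ∫ x, psiRatio ψ q q' i x ^ 2 ∂(law μ r i) ≤
      a₂ ^ 2 * (hellingerSq (law μ r i) (law μ q i) + hellingerSq (law μ r i) (law μ q' i))

/-- The statistic `T(x, q, q') = ∑ᵢ ψ(√(q'ᵢ(xᵢ) / qᵢ(xᵢ)))`. -/
def stat (ψ : ℝ≥0∞ → ℝ) (x : ∀ i, 𝒳 i) (q q' : ∀ i, 𝒳 i → ℝ≥0) : ℝ :=
  ∑ i, psiRatio ψ q q' i (x i)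

/-- The centred statistic `Z(x, q, q') = T(x, q, q') - E_P[T(X, q, q')]`, with `X` of law
`⨂ᵢ Pᵢ`. -/
def centredStat (ψ : ℝ≥0∞ → ℝ) (P : ∀ i, Measure (𝒳 i)) (x : ∀ i, 𝒳 i)
    (q q' : ∀ i, 𝒳 i → ℝ≥0) : ℝ :=
  stat ψ x q q' - ∫ y, stat ψ y q q' ∂(Measure.pi P)

/-- The process `q ↦ Z(X, p, q)` indexed by `𝒬`, under the law `⨂ᵢ Pᵢ` of `X`, is separable for the
distance `H` (automatic when `𝒬` is countable). -/
def IsSeparableProcess (ψ : ℝ≥0∞ → ℝ) (μ P : ∀ i, Measure (𝒳 i)) (𝒬 : Set (∀ i, 𝒳 i → ℝ≥0))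
    (p : ∀ i, 𝒳 i → ℝ≥0) : Prop :=
  ∃ S ⊆ 𝒬, S.Countable ∧ ∀ᵐ x ∂(Measure.pi P), ∀ q ∈ 𝒬, ∀ ε > 0, ∃ s ∈ S,
    lossSq (law μ s) (law μ q) < ε ∧ |centredStat ψ P x p s - centredStat ψ P x p q| < ε

/-- The expected supremum `E_P[sup |Z(X, p, q)|]` over those `q ∈ 𝒬` for which
`H²(P, p · μ) + H²(P, q · μ) < z` (zero if there is no such `q`). -/
def fluctuation (ψ : ℝ≥0∞ → ℝ) (μ P : ∀ i, Measure (𝒳 i)) (𝒬 : Set (∀ i, 𝒳 i → ℝ≥0))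
    (p : ∀ i, 𝒳 i → ℝ≥0) (z : ℝ) : ℝ :=
  ∫ x, ⨆ q : {q : ∀ i, 𝒳 i → ℝ≥0 // q ∈ 𝒬 ∧ lossSq P (law μ p) + lossSq P (law μ q) < z},
    |centredStat ψ P x p q| ∂(Measure.pi P)

/-- The local dimension `D(P, p · μ)` of the model described by `𝒬`: the largest scale at which the
fluctuations of the process still exceed `(a₁ / 8) z`, normalised by `(a₁ / (4 a₂))²` and
bounded below by `1`. -/
def dimension (a₁ a₂ : ℝ) (ψ : ℝ≥0∞ → ℝ) (μ P : ∀ i, Measure (𝒳 i))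
    (𝒬 : Set (∀ i, 𝒳 i → ℝ≥0)) (p : ∀ i, 𝒳 i → ℝ≥0) : ℝ :=
  max 1 ((a₁ / (4 * a₂)) ^ 2 *
    sSup {z : ℝ | 0 < z ∧ a₁ / 8 * z < fluctuation ψ μ P 𝒬 p z})

/-- The penalised criterion `Υ(x, q) = sup_{q' ∈ 𝒬} [T(x, q, q') - pen(q' · μ)] + pen(q · μ)`. -/
def criterion (ψ : ℝ≥0∞ → ℝ) (μ : ∀ i, Measure (𝒳 i)) (pen : (∀ i, Measure (𝒳 i)) → ℝ)
    (𝒬 : Set (∀ i, 𝒳 i → ℝ≥0)) (x : ∀ i, 𝒳 i) (q : ∀ i, 𝒳 i → ℝ≥0) : ℝ :=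
  (⨆ q' : 𝒬, (stat ψ x q q' - pen (law μ (q' : ∀ i, 𝒳 i → ℝ≥0)))) + pen (law μ q)

/-- `p̂` is a penalised `ρ`-estimator on `𝒬`: for every observation `x`, `p̂ x` minimises the
criterion over `𝒬`. -/
def IsRhoEstimator (ψ : ℝ≥0∞ → ℝ) (μ : ∀ i, Measure (𝒳 i)) (pen : (∀ i, Measure (𝒳 i)) → ℝ)
    (𝒬 : Set (∀ i, 𝒳 i → ℝ≥0)) (phat : (∀ i, 𝒳 i) → ∀ i, 𝒳 i → ℝ≥0) : Prop :=
  ∀ x, phat x ∈ 𝒬 ∧ ∀ q ∈ 𝒬, criterion ψ μ pen 𝒬 x (phat x) ≤ criterion ψ μ pen 𝒬 x q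

end

end RhoEst

open RhoEst

/-!
The argument compares the values of the criterion at the estimator and at a reference density `p`
of the model (`stat_le_of_isRhoEstimator`). Both are controlled by the process
`q ↦ T(x, p, q)`, that is by its mean and by its fluctuations `Z(x, p, q)` around the mean.

*The mean.* The moment inequalities are assumed under laws of the model, whereas the observations
have an arbitrary law `P`. Applied under `p · μ` and transferred to `P` at the price of a multiple
of `H²(P, p · μ)`, they show that the mean of `T(·, p, q)` is at most
`C H²(P, p · μ) - (7/8) a₁ H²(P, q · μ)` (`integral_stat_le`) and that the variance is at most a
multiple of `H²(P, p · μ) + H²(P, q · μ)` (`sum_integral_centredPsi_sq_le`).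

*The fluctuations.* What is needed is an upper deviation inequality for suprema of sums of
independent variables that need not be identically distributed. It has to involve the supremum of
the variances of the sums and not the sum of the suprema, and its factor in front of the
expectation has to be less than `7 / 2`: the definition of the dimension provides `a₁ / 8`, dyadic
peeling loses a factor two, and the result has to stay below the `7 / 8` of the mean. The
inequality `measure_exists_abs_sum_gt_le` has the factor two. It comes from a differential
inequality for the log-Laplace transform of the maximum `Z` (`entropy_exp_le`, integrated in
`cgf_le`), in the manner of Klein and Rio. The entropy of `f = exp (t Z)` is the sum over the
coordinates of `E[f log r]`, where `r` is the ratio of two successive conditional expectations of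
`f`. In each coordinate `f` is compared with the average `g ≤ f` for which the maximising
index is drawn from an independent copy of the coordinate. The part of `g` gives the variance at
the maximising index; the parts of `f - g` add up to a multiple of `t² E[Z f]`, which is absorbed
by the left-hand side. All this is `integral_exp_mul_log_le`. Separability reduces suprema over a
model to countable ones, and a union bound over the dyadic shells (`exists_abs_centredStat_le`) and
the models, with the weights `exp (-Δ m)`, gives
`|Z(x, p, q)| ≤ (3/4) a₁ (H²(P, p · μ) + H²(P, q · μ)) + κ (D + Δ m + ξ)` for all `m` and all `q` in
the model `m` at once. The last term is absorbed by the penalty and `7/8 - 3/4 > 0`, whence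
`exists_lossSq_le`.

*The oracle inequality* takes for `p` a density that is optimal up to a factor two, which exists
since dimensions are at least one. The bound in expectation sums the deviation bounds over integer
levels `ξ = 1, …, n`; more are not needed because the loss is at most `n`
(`exists_integrable_bound`).
-/

namespace RhoEst

lemma integrable_of_abs_le {Ω : Type*} [MeasurableSpace Ω] {ν : Measure Ω} [IsFiniteMeasure ν]
    {f : Ω → ℝ} (hf : Measurable f) {C : ℝ} (hC : ∀ x, |f x| ≤ C) : Integrable f ν :=
  .of_bound hf.aestronglyMeasurable C (ae_of_all _ hC)

lemma measurable_integral_prod {α β : Type*} [MeasurableSpace α] [MeasurableSpace β]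
    (ν : Measure β) [SFinite ν] {H : α × β → ℝ} (hH : Measurable H) :
    Measurable fun x => ∫ z, H (x, z) ∂ν :=
  hH.stronglyMeasurable.integral_prod_right'.measurable

/-! ### Conditional expectations on a product space -/

section Resampling

variable {n : ℕ} {𝒳 : Fin n → Type*} [∀ i, MeasurableSpace (𝒳 i)]
  (P : ∀ i, Measure (𝒳 i))

/-- The point whose first `k` coordinates are those of `x` and whose other coordinates are those
of `y`. -/
def splice (k : ℕ) (x y : ∀ i, 𝒳 i) : ∀ i, 𝒳 i := fun i => if i.1 < k then x i else y i

/-- The conditional expectation of `f` given the first `k` coordinates. -/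
noncomputable def prefixMean (f : (∀ i, 𝒳 i) → ℝ) (k : ℕ) (x : ∀ i, 𝒳 i) : ℝ :=
  ∫ y, f (splice k x y) ∂(Measure.pi P)

lemma measurable_splice (k : ℕ) :
    Measurable fun p : (∀ i, 𝒳 i) × (∀ i, 𝒳 i) => splice k p.1 p.2 := by
  refine measurable_pi_lambda _ fun i => ?_
  by_cases hi : i.1 < k
  · simp only [splice, hi, if_true]; fun_prop
  · simp only [splice, hi, if_false]; fun_prop

variable {P} {f : (∀ i, 𝒳 i) → ℝ}

lemma prefixMean_zero (x : ∀ i, 𝒳 i) : prefixMean P f 0 x = ∫ y, f y ∂(Measure.pi P) := by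
  have : ∀ y, splice 0 x y = y := fun y => by ext i; simp [splice]
  simp [prefixMean, this]

lemma prefixMean_update_self (k : Fin n) (x : ∀ i, 𝒳 i) (z : 𝒳 k) :
    prefixMean P f k (Function.update x k z) = prefixMean P f k x := by
  unfold prefixMean
  congr 1
  ext y
  congr 1
  ext i
  by_cases hi : i = k
  · subst hi; simp [splice]
  · simp [splice, hi]

variable (P) [∀ i, IsProbabilityMeasure (P i)]

/-- Replacing one coordinate of a vector of law `⨂ᵢ Pᵢ` by an independent copy does not change the
law. -/
lemma measurePreserving_update (k : Fin n) :
    MeasurePreserving (fun p : (∀ i, 𝒳 i) × 𝒳 k => Function.update p.1 k p.2)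
      ((Measure.pi P).prod (P k)) (Measure.pi P) := by
  refine ⟨measurable_update', ?_⟩
  symm
  refine Measure.pi_eq fun s hs => ?_
  rw [Measure.map_apply measurable_update' (MeasurableSet.univ_pi hs)]
  have : (fun p : (∀ i, 𝒳 i) × 𝒳 k => Function.update p.1 k p.2) ⁻¹' Set.univ.pi s =
      (Set.univ.pi (Function.update s k Set.univ)) ×ˢ (s k) := by
    ext ⟨x, z⟩
    simp only [Set.mem_preimage, Set.mem_pi, Set.mem_univ, true_implies, Set.mem_prod]
    constructor
    · intro h
      refine ⟨fun i => ?_, by simpa using h k⟩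
      by_cases hi : i = k
      · subst hi; simp
      · simpa [hi] using h i
    · rintro ⟨h, hz⟩ i
      by_cases hi : i = k
      · subst hi; simpa using hz
      · simpa [hi] using h i
  rw [this, Measure.prod_prod, Measure.pi_pi, ← Finset.mul_prod_erase _ _ (Finset.mem_univ k),
    ← Finset.mul_prod_erase _ (fun i => P i (s i)) (Finset.mem_univ k)]
  have : ∀ i ∈ Finset.univ.erase k, P i (Function.update s k Set.univ i) = P i (s i) := by
    intro i hi
    rw [Function.update_of_ne (Finset.ne_of_mem_erase hi)]
  rw [Finset.prod_congr rfl this]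
  simp [mul_comm]

lemma integral_integral_update (k : Fin n) {h : (∀ i, 𝒳 i) → ℝ} (hh : Measurable h) {C : ℝ}
    (hC : ∀ x, |h x| ≤ C) :
    ∫ x, ∫ z, h (Function.update x k z) ∂(P k) ∂(Measure.pi P) = ∫ x, h x ∂(Measure.pi P) := by
  rw [← (measurePreserving_update P k).map_eq, integral_map measurable_update'.aemeasurable
    hh.aestronglyMeasurable, integral_prod]
  · rw [(measurePreserving_update P k).map_eq]
  · exact integrable_of_abs_le (hh.comp measurable_update') fun _ => hC _

variable {P}

lemma measurable_prefixMean (hf : Measurable f) (k : ℕ) : Measurable (prefixMean P f k) :=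
  measurable_integral_prod _ (hf.comp (measurable_splice k))

lemma prefixMean_mem_Icc (hf : Measurable f) {a b : ℝ} (ha : ∀ x, a ≤ f x) (hb : ∀ x, f x ≤ b)
    (k : ℕ) (x : ∀ i, 𝒳 i) : prefixMean P f k x ∈ Set.Icc a b := by
  have hm : Measurable fun y => f (splice k x y) :=
    hf.comp ((measurable_splice k).comp measurable_prodMk_left)
  have hi : Integrable (fun y => f (splice k x y)) (Measure.pi P) :=
    integrable_of_abs_le hm (C := max |a| |b|) fun y => abs_le_max_abs_abs (ha _) (hb _)
  constructor
  · have := integral_mono (integrable_const a) hi fun y => ha _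
    simpa [prefixMean] using this
  · have := integral_mono hi (integrable_const b) fun y => hb _
    simpa [prefixMean] using this

lemma prefixMean_last (x : ∀ i, 𝒳 i) : prefixMean P f n x = f x := by
  have : ∀ y, splice n x y = x := fun y => by ext i; simp [splice, i.2]
  simp [prefixMean, this]

lemma integral_prefixMean_succ_update (hf : Measurable f) {C : ℝ} (hC : ∀ x, |f x| ≤ C)
    (k : Fin n) (x : ∀ i, 𝒳 i) :
    ∫ z, prefixMean P f (k + 1) (Function.update x k z) ∂(P k) = prefixMean P f k x := by
  have key : ∀ z y, splice (k + 1) (Function.update x k z) y =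
      splice k x (Function.update y k z) := by
    intro z y
    ext i
    by_cases hi : i = k
    · subst hi; simp [splice]
    · have : i.1 < k.1 + 1 ↔ i.1 < k.1 := by
        have : i.1 ≠ k.1 := fun h => hi (Fin.ext h)
        omega
      simp [splice, hi, this]
  have hm : Measurable fun y => f (splice k x y) :=
    hf.comp ((measurable_splice k).comp measurable_prodMk_left)
  simp only [prefixMean, key]
  rw [integral_integral_swap]
  · exact integral_integral_update P k hm fun _ => hC _
  · exact integrable_of_abs_le (hm.comp (measurable_update'.comp measurable_swap))
      fun _ => hC _

lemma prefixMean_succ_le (hf : Measurable f) {C : ℝ} (hC : ∀ x, |f x| ≤ C) {c : ℝ}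
    {k : Fin n} (hk : ∀ x z, f x ≤ c * f (Function.update x k z)) (x : ∀ i, 𝒳 i) :
    prefixMean P f (k + 1) x ≤ c * prefixMean P f k x := by
  have key : ∀ y, splice k x y = Function.update (splice (k + 1) x y) k (y k) := by
    intro y
    ext i
    by_cases hi : i = k
    · subst hi; simp [splice]
    · have : i.1 < k.1 + 1 ↔ i.1 < k.1 := by
        have : i.1 ≠ k.1 := fun h => hi (Fin.ext h)
        omega
      simp [splice, hi, this]
  have hm : ∀ j, Measurable fun y => f (splice j x y) := fun j =>
    hf.comp ((measurable_splice j).comp measurable_prodMk_left)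
  rw [prefixMean, prefixMean, ← integral_const_mul]
  refine integral_mono (integrable_of_abs_le (hm _) fun _ => hC _)
    ((integrable_of_abs_le (hm _) fun _ => hC _).const_mul _) fun y => ?_
  dsimp only
  rw [key y]
  exact hk _ _

/-- The logarithm of `f / E f` is the sum of the logarithms of the successive ratios of its
martingale of conditional expectations. -/
lemma log_sub_log_integral (x : ∀ i, 𝒳 i) :
    Real.log (f x) - Real.log (∫ y, f y ∂(Measure.pi P)) =
      ∑ k : Fin n, (Real.log (prefixMean P f (k + 1) x) - Real.log (prefixMean P f k x)) := by
  rw [Fin.sum_univ_eq_sum_range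
    (fun k => Real.log (prefixMean P f (k + 1) x) - Real.log (prefixMean P f k x)) n,
    Finset.sum_range_sub (fun k => Real.log (prefixMean P f k x)), prefixMean_zero,
    prefixMean_last]

end Resampling

/-! ### Entropy in one coordinate -/

section OneCoordinate

/-- The entropy bound in one coordinate. The weight `r` has integral one, and `j z` is the index at
which `a j + s j z` is largest. Compared with `exp (t (a (j z) + s (j z) z))`, the average
`g z' = ∫ exp (t (a (j z) + s (j z) z'))` decouples the index from the coordinate: its contribution
is of second order in `t`, with the variance at the maximising index, while the remainder is
nonnegative and has an integral of first order. -/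
lemma integral_exp_mul_log_le {Y ι : Type*} [MeasurableSpace Y] [Countable ι] [MeasurableSpace ι]
    [DiscreteMeasurableSpace ι] (ν : Measure Y) [IsProbabilityMeasure ν]
    {s : ι → Y → ℝ} (hs : ∀ j, Measurable (s j)) (hb : ∀ j z, |s j z| ≤ 2)
    (h0 : ∀ j, ∫ z, s j z ∂ν = 0) {a : ι → ℝ} {A : ℝ} (ha : ∀ j, |a j| ≤ A)
    {j : Y → ι} (hj : Measurable j) (hmax : ∀ i z, a i + s i z ≤ a (j z) + s (j z) z)
    {r : Y → ℝ} (hr : Measurable r) (hr0 : ∀ z, 0 < r z) {B : ℝ}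
    (hrB : ∀ z, |Real.log (r z)| ≤ B) (hr1 : ∫ z, r z ∂ν = 1) {t : ℝ} (ht0 : 0 ≤ t)
    (ht : t ≤ 1 / 8) (hrt : ∀ z, Real.log (r z) ≤ 4 * t) :
    ∫ z, Real.exp (t * (a (j z) + s (j z) z)) * Real.log (r z) ∂ν ≤
      ∫ z, Real.exp (t * (a (j z) + s (j z) z)) *
        (4 * t ^ 2 * (∫ y, s (j z) y ^ 2 ∂ν) + 4 * t ^ 2 * s (j z) z) ∂ν := by
  have hsm : Measurable fun p : ι × Y => s p.1 p.2 := measurable_from_prod_countable_right hs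
  have ham : Measurable a := measurable_of_countable _
  have hajm : Measurable fun z => a (j z) := ham.comp hj
  have hsj : Measurable fun z => s (j z) z := hsm.comp (hj.prodMk measurable_id)
  have hlog : Measurable fun z => Real.log (r z) := Real.measurable_log.comp hr
  have hv : ∀ i, 0 ≤ ∫ y, s i y ^ 2 ∂ν ∧ ∫ y, s i y ^ 2 ∂ν ≤ 4 := by
    intro i
    refine ⟨integral_nonneg fun _ => sq_nonneg _, ?_⟩
    have : ∫ y, s i y ^ 2 ∂ν ≤ ∫ _, (4 : ℝ) ∂ν := by
      refine integral_mono_of_nonneg (ae_of_all _ fun _ => sq_nonneg _) (integrable_const _)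
        (ae_of_all _ fun y => ?_)
      have := hb i y
      dsimp only
      rw [← sq_abs]
      nlinarith [abs_nonneg (s i y)]
    simpa using this
  have hexp : ∀ i z, Real.exp (t * (a i + s i z)) ≤ Real.exp (A + 2) := by
    intro i z
    apply Real.exp_le_exp.2
    have h1 := (abs_le.1 (ha i)).2
    have h2 := (abs_le.1 (hb i z)).2
    have h3 : 0 ≤ A := (abs_nonneg _).trans (ha i)
    nlinarith
  have hexp1 : ∀ i, Real.exp (t * a i) ≤ Real.exp A := by
    intro i
    apply Real.exp_le_exp.2
    have h1 := (abs_le.1 (ha i)).2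
    have h3 : 0 ≤ A := (abs_nonneg _).trans (ha i)
    nlinarith
  have hexp2 : ∀ i z, Real.exp (t * s i z) ≤ Real.exp 2 := by
    intro i z
    apply Real.exp_le_exp.2
    have h1 := (abs_le.1 (hb i z)).2
    nlinarith
  set f : Y → ℝ := fun z => Real.exp (t * (a (j z) + s (j z) z))
  have hfm : Measurable f := Real.measurable_exp.comp ((hajm.add hsj).const_mul t)
  have hfB : ∀ z, |f z| ≤ Real.exp (A + 2) := fun z => by
    rw [abs_of_pos (Real.exp_pos _)]; exact hexp _ _
  set G : Y → Y → ℝ := fun z' z => Real.exp (t * (a (j z) + s (j z) z')) with hG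
  have hGm : Measurable (Function.uncurry G) := by
    refine Real.measurable_exp.comp (((hajm.comp measurable_snd).add ?_).const_mul t)
    exact hsm.comp ((hj.comp measurable_snd).prodMk measurable_fst)
  have hGB : ∀ z' z, |G z' z| ≤ Real.exp (A + 2) := fun z' z => by
    rw [abs_of_pos (Real.exp_pos _)]; exact hexp _ _
  have hGf : ∀ z' z, G z' z ≤ f z' := fun z' z =>
    Real.exp_le_exp.2 (mul_le_mul_of_nonneg_left (hmax _ _) ht0)
  have hGi : ∀ z', Integrable (G z') ν := fun z' =>
    integrable_of_abs_le (hGm.comp measurable_prodMk_left) (hGB z')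
  -- The average of `f` over an independent draw of the maximising index.
  set g : Y → ℝ := fun z' => ∫ z, G z' z ∂ν with hg
  have hgm : Measurable g := measurable_integral_prod ν hGm
  have hgf : ∀ z', g z' ≤ f z' := fun z' => by
    simpa using integral_mono (hGi z') (integrable_const (f z')) (hGf z')
  have hg0 : ∀ z', 0 ≤ g z' := fun z' => integral_nonneg fun z => (Real.exp_pos _).le
  have hgB : ∀ z', |g z'| ≤ Real.exp (A + 2) := fun z' => by
    rw [abs_of_nonneg (hg0 z')]
    exact (hgf z').trans ((le_abs_self _).trans (hfB z'))
  have hB0 : 0 ≤ Real.exp (A + 2) := (Real.exp_pos _).le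
  have hfi : Integrable f ν := integrable_of_abs_le hfm hfB
  have hgi : Integrable g ν := integrable_of_abs_le hgm hgB
  have hmulB : ∀ u : Y → ℝ, (∀ z, |u z| ≤ Real.exp (A + 2)) →
      ∀ z, |u z * Real.log (r z)| ≤ Real.exp (A + 2) * B := fun u hu z => by
    rw [abs_mul]; exact mul_le_mul (hu z) (hrB z) (abs_nonneg _) hB0
  have hfli : Integrable (fun z => f z * Real.log (r z)) ν :=
    integrable_of_abs_le (hfm.mul hlog) (hmulB f hfB)
  have hgli : Integrable (fun z => g z * Real.log (r z)) ν :=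
    integrable_of_abs_le (hgm.mul hlog) (hmulB g hgB)
  have hfgi : Integrable (fun z => (f z - g z) * Real.log (r z)) ν := by
    simp only [sub_mul]; exact hfli.sub hgli
  have hsB : ∀ z, |s (j z) z| ≤ 2 := fun z => hb _ _
  have hvm : Measurable fun z => ∫ y, s (j z) y ^ 2 ∂ν :=
    (measurable_of_countable fun i => ∫ y, s i y ^ 2 ∂ν).comp hj
  have hfs : Integrable (fun z => f z * s (j z) z) ν :=
    integrable_of_abs_le (hfm.mul hsj) (C := Real.exp (A + 2) * 2) fun z => by
      rw [abs_mul]; exact mul_le_mul (hfB z) (hsB z) (abs_nonneg _) hB0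
  have hfv : Integrable (fun z => f z * ∫ y, s (j z) y ^ 2 ∂ν) ν :=
    integrable_of_abs_le (hfm.mul hvm) (C := Real.exp (A + 2) * 4) fun z => by
      rw [abs_mul, abs_of_nonneg (hv (j z)).1]
      exact mul_le_mul (hfB z) (hv _).2 (hv _).1 hB0
  have hsi : ∀ i, Integrable (s i) ν := fun i => integrable_of_abs_le (hs i) (hb i)
  have hGprod : ∀ z' z, G z' z = Real.exp (t * a (j z)) * Real.exp (t * s (j z) z') :=
    fun z' z => by rw [← Real.exp_add]; simp only [hG]; ring_nf
  have hfprod : ∀ z, f z = Real.exp (t * a (j z)) * Real.exp (t * s (j z) z) := fun z => hGprod z z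
  have hesi : ∀ i, Integrable (fun z' => Real.exp (t * s i z')) ν := fun i =>
    integrable_of_abs_le (Real.measurable_exp.comp ((hs i).const_mul t)) (C := Real.exp 2)
      fun z => by rw [abs_of_pos (Real.exp_pos _)]; exact hexp2 _ _
  have hri : Integrable r ν := by
    by_contra h
    rw [integral_undef h] at hr1
    exact zero_ne_one hr1
  -- For a fixed index, the duality between entropy and exponential moments.
  have hdual : ∀ i, ∫ z', Real.exp (t * s i z') * Real.log (r z') ∂ν ≤
      3 * t ^ 2 * ∫ y, s i y ^ 2 ∂ν := by
    intro i
    have hpt : ∀ z', Real.exp (t * s i z') * Real.log (r z') ≤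
        (r z' - 1) + 3 * t ^ 2 * s i z' ^ 2 := by
      intro z'
      set u := t * s i z' with hu
      have hu1 : |u| ≤ 1 := by
        rw [hu, abs_mul, abs_of_nonneg ht0]
        nlinarith [hb i z', abs_nonneg (s i z')]
      have h1 : Real.log (r z') - u ≤ r z' * Real.exp (-u) - 1 := by
        have := Real.log_le_sub_one_of_pos (mul_pos (hr0 z') (Real.exp_pos (-u)))
        rw [Real.log_mul (hr0 z').ne' (Real.exp_pos _).ne', Real.log_exp] at this
        linarith
      have h2 := mul_le_mul_of_nonneg_left h1 (Real.exp_pos u).le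
      have h3 : Real.exp u * Real.exp (-u) = 1 := by rw [← Real.exp_add]; simp
      have h4 : Real.exp (-u) - 1 + u ≤ u ^ 2 := by
        have := (abs_le.1 (Real.abs_exp_sub_one_sub_id_le (x := -u) (by rwa [abs_neg]))).2
        rw [neg_sq] at this
        linarith
      have h5 := mul_le_mul_of_nonneg_left h4 (Real.exp_pos u).le
      have h6 : Real.exp u ≤ 3 :=
        (Real.exp_le_exp.2 (abs_le.1 hu1).2).trans Real.exp_one_lt_three.le
      have h7 := mul_le_mul_of_nonneg_right h6 (sq_nonneg u)
      have h8 : u ^ 2 = t ^ 2 * s i z' ^ 2 := by rw [hu]; ring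
      have h9 : Real.exp u * (r z' * Real.exp (-u) - 1) = r z' - Real.exp u := by
        linear_combination (r z') * h3
      have h10 : Real.exp u * (Real.exp (-u) - 1 + u) = 1 - Real.exp u + Real.exp u * u := by
        linear_combination h3
      rw [h9] at h2
      rw [h10] at h5
      linarith
    have hs2 : Integrable (fun y => s i y ^ 2) ν :=
      integrable_of_abs_le ((hs i).pow_const 2) (C := 4) fun y => by
        rw [abs_of_nonneg (sq_nonneg _), ← sq_abs]
        nlinarith [hb i y, abs_nonneg (s i y)]
    have hint : Integrable (fun z' => Real.exp (t * s i z') * Real.log (r z')) ν :=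
      integrable_of_abs_le ((Real.measurable_exp.comp ((hs i).const_mul t)).mul hlog)
        (C := Real.exp 2 * B) fun z => by
          rw [abs_mul, abs_of_pos (Real.exp_pos _)]
          exact mul_le_mul (hexp2 _ _) (hrB z) (abs_nonneg _) (Real.exp_pos _).le
    have hr1i : Integrable (fun z => r z - 1) ν := hri.sub (integrable_const 1)
    refine (integral_mono hint (hr1i.add (hs2.const_mul _)) hpt).trans (le_of_eq ?_)
    rw [integral_add' hr1i (hs2.const_mul _), integral_sub hri (integrable_const 1), hr1,
      integral_const_mul]
    simp
  have hfirst : ∫ z', g z' * Real.log (r z') ∂ν ≤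
      4 * t ^ 2 * ∫ z, f z * ∫ y, s (j z) y ^ 2 ∂ν ∂ν := by
    have hswap : ∫ z', g z' * Real.log (r z') ∂ν =
        ∫ z, Real.exp (t * a (j z)) *
          ∫ z', Real.exp (t * s (j z) z') * Real.log (r z') ∂ν ∂ν := by
      calc ∫ z', g z' * Real.log (r z') ∂ν
          = ∫ z', ∫ z, G z' z * Real.log (r z') ∂ν ∂ν := by
            simp only [hg, integral_mul_const]
        _ = ∫ z, ∫ z', G z' z * Real.log (r z') ∂ν ∂ν := by
            refine integral_integral_swap ?_
            refine integrable_of_abs_le (hGm.mul (hlog.comp measurable_fst))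
              (C := Real.exp (A + 2) * B) fun p => ?_
            simp only [Function.uncurry]
            rw [abs_mul]
            exact mul_le_mul (hGB _ _) (hrB _) (abs_nonneg _) hB0
        _ = _ := by simp only [hGprod, mul_assoc, integral_const_mul]
    rw [hswap, ← integral_const_mul]
    have hIB : ∀ i, |∫ z', Real.exp (t * s i z') * Real.log (r z') ∂ν| ≤ Real.exp 2 * B := by
      intro i
      have := norm_integral_le_of_norm_le_const (μ := ν) (C := Real.exp 2 * B)
        (f := fun z' => Real.exp (t * s i z') * Real.log (r z')) (ae_of_all _ fun z' => by
          rw [Real.norm_eq_abs, abs_mul, abs_of_pos (Real.exp_pos _)]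
          exact mul_le_mul (hexp2 _ _) (hrB z') (abs_nonneg _) (Real.exp_pos _).le)
      simpa using this
    refine integral_mono ?_ (hfv.const_mul _) fun z => ?_
    · refine integrable_of_abs_le ((Real.measurable_exp.comp (hajm.const_mul t)).mul
        ((measurable_of_countable fun i =>
          ∫ z', Real.exp (t * s i z') * Real.log (r z') ∂ν).comp hj))
        (C := Real.exp A * (Real.exp 2 * B)) fun z => ?_
      rw [abs_mul, abs_of_pos (Real.exp_pos _)]
      exact mul_le_mul (hexp1 _) (hIB _) (abs_nonneg _) (Real.exp_pos _).le
    · have h1 := mul_le_mul_of_nonneg_left (hdual (j z)) (Real.exp_pos (t * a (j z))).le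
      refine h1.trans ?_
      have h2 : Real.exp (t * a (j z)) * 3 ≤ f z * 4 := by
        rw [hfprod, mul_assoc]
        refine mul_le_mul_of_nonneg_left ?_ (Real.exp_pos _).le
        have h3 := Real.add_one_le_exp (t * s (j z) z)
        have h4 := (abs_le.1 (hb (j z) z)).1
        nlinarith
      have h3 := mul_le_mul_of_nonneg_left h2 (mul_nonneg (sq_nonneg t) (hv (j z)).1)
      linarith
  -- The remainder `f - g` is nonnegative, so that the bound on `log r` applies; the integral of `g`
  -- is bounded below by Jensen's inequality, since the `s i` are centred.
  have hsecond : ∫ z', (f z' - g z') * Real.log (r z') ∂ν ≤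
      4 * t ^ 2 * ∫ z, f z * s (j z) z ∂ν := by
    have h1 : ∫ z', (f z' - g z') * Real.log (r z') ∂ν ≤ 4 * t * ∫ z', (f z' - g z') ∂ν := by
      rw [← integral_const_mul]
      refine integral_mono ?_ ((hfi.sub hgi).const_mul _) fun z => ?_
      · exact hfgi
      · dsimp only
        rw [mul_comm (4 * t)]
        exact mul_le_mul_of_nonneg_left (hrt z) (sub_nonneg.2 (hgf z))
    have h2 : ∫ z, f z - t * (f z * s (j z) z) ∂ν ≤ ∫ z', g z' ∂ν := by
      have hswap : ∫ z', g z' ∂ν =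
          ∫ z, Real.exp (t * a (j z)) * ∫ z', Real.exp (t * s (j z) z') ∂ν ∂ν := by
        calc ∫ z', g z' ∂ν = ∫ z, ∫ z', G z' z ∂ν ∂ν :=
              integral_integral_swap (integrable_of_abs_le hGm fun p => hGB _ _)
          _ = _ := by simp only [hGprod, integral_const_mul]
      have hone : ∀ i, 1 ≤ ∫ z', Real.exp (t * s i z') ∂ν := fun i => by
        have : ∫ z', (1 + t * s i z') ∂ν ≤ ∫ z', Real.exp (t * s i z') ∂ν :=
          integral_mono ((integrable_const 1).add ((hsi i).const_mul t)) (hesi i) fun z' => by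
            have := Real.add_one_le_exp (t * s i z')
            dsimp only
            linarith
        rw [integral_add (integrable_const 1) ((hsi i).const_mul t), integral_const_mul, h0] at this
        simpa using this
      have hJB : ∀ i, |∫ z', Real.exp (t * s i z') ∂ν| ≤ Real.exp 2 := fun i => by
        have := norm_integral_le_of_norm_le_const (μ := ν) (C := Real.exp 2)
          (f := fun z' => Real.exp (t * s i z')) (ae_of_all _ fun z' => by
            rw [Real.norm_eq_abs, abs_of_pos (Real.exp_pos _)]
            exact hexp2 _ _)
        simpa using this
      rw [hswap]
      refine integral_mono (hfi.sub (hfs.const_mul t)) ?_ fun z => ?_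
      · refine integrable_of_abs_le ((Real.measurable_exp.comp (hajm.const_mul t)).mul
          ((measurable_of_countable fun i => ∫ z', Real.exp (t * s i z') ∂ν).comp hj))
          (C := Real.exp A * Real.exp 2) fun z => ?_
        rw [abs_mul, abs_of_pos (Real.exp_pos _)]
        exact mul_le_mul (hexp1 _) (hJB _) (abs_nonneg _) (Real.exp_pos _).le
      · dsimp only
        have h3 : f z * (1 - t * s (j z) z) ≤ Real.exp (t * a (j z)) := by
          rw [hfprod, mul_assoc]
          refine mul_le_of_le_one_right (Real.exp_pos _).le ?_
          have h4 := Real.add_one_le_exp (-(t * s (j z) z))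
          have h5 : Real.exp (t * s (j z) z) * Real.exp (-(t * s (j z) z)) = 1 := by
            rw [← Real.exp_add]; simp
          nlinarith [Real.exp_pos (t * s (j z) z)]
        have h6 := mul_le_mul_of_nonneg_left (hone (j z)) (Real.exp_pos (t * a (j z))).le
        linarith
    rw [integral_sub hfi (hfs.const_mul t), integral_const_mul] at h2
    rw [integral_sub hfi hgi] at h1
    nlinarith [mul_le_mul_of_nonneg_left h2 ht0]
  calc ∫ z, f z * Real.log (r z) ∂ν
      = ∫ z, g z * Real.log (r z) ∂ν + ∫ z, (f z - g z) * Real.log (r z) ∂ν := by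
        rw [← integral_add hgli hfgi]
        congr 1; ext z; ring
    _ ≤ 4 * t ^ 2 * (∫ z, f z * ∫ y, s (j z) y ^ 2 ∂ν ∂ν) +
        4 * t ^ 2 * ∫ z, f z * s (j z) z ∂ν := add_le_add hfirst hsecond
    _ = _ := by
        rw [← integral_const_mul, ← integral_const_mul,
          ← integral_add (hfv.const_mul _) (hfs.const_mul _)]
        congr 1; ext z; ring

end OneCoordinate

/-! ### Laplace transform of a maximum of independent sums -/

section Suprema

lemma abs_sum_le_two_mul {n : ℕ} {𝒳 : Fin n → Type*} {ι : Type*}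
    {s : ι → ∀ k, 𝒳 k → ℝ} (hb : ∀ j k x, |s j k x| ≤ 2) (j : ι) (x : ∀ i, 𝒳 i) :
    |∑ k, s j k (x k)| ≤ 2 * n := by
  calc |∑ k, s j k (x k)| ≤ ∑ k, |s j k (x k)| := Finset.abs_sum_le_sum_abs _ _
    _ ≤ ∑ _k : Fin n, 2 := Finset.sum_le_sum fun k _ => hb _ _ _
    _ = 2 * n := by simp [mul_comm]

variable {n : ℕ} {𝒳 : Fin n → Type*} [∀ i, MeasurableSpace (𝒳 i)]
  {P : ∀ i, Measure (𝒳 i)} [∀ i, IsProbabilityMeasure (P i)]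
  {ι : Type*} [Countable ι] [MeasurableSpace ι] [DiscreteMeasurableSpace ι]
  {s : ι → ∀ k, 𝒳 k → ℝ} {τ : (∀ i, 𝒳 i) → ι}

lemma measurable_sum_argmax (hs : ∀ j k, Measurable (s j k)) (hτ : Measurable τ) :
    Measurable fun x => ∑ k, s (τ x) k (x k) := by
  refine Finset.measurable_sum _ fun k _ => ?_
  have : Measurable fun p : ι × 𝒳 k => s p.1 k p.2 :=
    measurable_from_prod_countable_right fun j => hs j k
  exact this.comp (hτ.prodMk (measurable_pi_apply k))

/-- The entropy of `exp (t Z)`, where `Z` is the maximum of centred sums of independent variables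
with variance at most `V`. -/
lemma entropy_exp_le (hs : ∀ j k, Measurable (s j k)) (hb : ∀ j k x, |s j k x| ≤ 2)
    (h0 : ∀ j k, ∫ y, s j k y ∂(P k) = 0) {V : ℝ} (hV : ∀ j, ∑ k, ∫ y, s j k y ^ 2 ∂(P k) ≤ V)
    (hτ : Measurable τ) (hmax : ∀ x j, ∑ k, s j k (x k) ≤ ∑ k, s (τ x) k (x k))
    {t : ℝ} (ht0 : 0 ≤ t) (ht : t ≤ 1 / 8) {Z : (∀ i, 𝒳 i) → ℝ}
    (hZ : ∀ x, Z x = ∑ k, s (τ x) k (x k)) :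
    t * (∫ x, Z x * Real.exp (t * Z x) ∂(Measure.pi P)) -
        (∫ x, Real.exp (t * Z x) ∂(Measure.pi P)) *
          Real.log (∫ x, Real.exp (t * Z x) ∂(Measure.pi P)) ≤
      4 * t ^ 2 * V * (∫ x, Real.exp (t * Z x) ∂(Measure.pi P)) +
        4 * t ^ 2 * ∫ x, Z x * Real.exp (t * Z x) ∂(Measure.pi P) := by
  set f : (∀ i, 𝒳 i) → ℝ := fun x => Real.exp (t * Z x) with hf
  have hZm : Measurable Z := by
    rw [funext hZ]; exact measurable_sum_argmax hs hτ
  have hZB : ∀ x, |Z x| ≤ 2 * n := fun x => by rw [hZ]; exact abs_sum_le_two_mul hb _ _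
  have hfm : Measurable f := Real.measurable_exp.comp (hZm.const_mul t)
  have htZ : ∀ x, |t * Z x| ≤ 2 * n := fun x => by
    rw [abs_mul, abs_of_nonneg ht0]
    nlinarith [hZB x, abs_nonneg (Z x)]
  have hlo : ∀ x, Real.exp (-(2 * n)) ≤ f x := fun x =>
    Real.exp_le_exp.2 (abs_le.1 (htZ x)).1
  have hhi : ∀ x, f x ≤ Real.exp (2 * n) := fun x =>
    Real.exp_le_exp.2 (abs_le.1 (htZ x)).2
  have hfB : ∀ x, |f x| ≤ Real.exp (2 * n) := fun x => by
    rw [abs_of_pos (Real.exp_pos _)]; exact hhi x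
  have hA := fun k x => prefixMean_mem_Icc (P := P) hfm hlo hhi k x
  have hA0 : ∀ k x, 0 < prefixMean P f k x := fun k x => (Real.exp_pos _).trans_le (hA k x).1
  have hlogA : ∀ k x, |Real.log (prefixMean P f k x)| ≤ 2 * n := fun k x => by
    refine abs_le.2 ⟨?_, ?_⟩
    · rw [Real.le_log_iff_exp_le (hA0 k x)]; exact (hA k x).1
    · rw [Real.log_le_iff_le_exp (hA0 k x)]; exact (hA k x).2
  have hAm := fun k => measurable_prefixMean (P := P) hfm k
  set L : Fin n → (∀ i, 𝒳 i) → ℝ := fun k x =>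
    Real.log (prefixMean P f (k + 1) x) - Real.log (prefixMean P f k x)
  have hLm : ∀ k, Measurable (L k) := fun k =>
    (Real.measurable_log.comp (hAm _)).sub (Real.measurable_log.comp (hAm _))
  have hLB : ∀ k x, |L k x| ≤ 4 * n := fun k x => by
    have := abs_sub (Real.log (prefixMean P f (k + 1) x)) (Real.log (prefixMean P f k x))
    linarith [hlogA (k + 1) x, hlogA k x]
  have hfLm : ∀ k, Measurable fun x => f x * L k x := fun k => hfm.mul (hLm k)
  have hfLi : ∀ k, Integrable (fun x => f x * L k x) (Measure.pi P) := fun k =>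
    integrable_of_abs_le (hfLm k) (C := Real.exp (2 * n) * (4 * n)) fun x => by
      rw [abs_mul]; exact mul_le_mul (hfB x) (hLB k x) (abs_nonneg _) (Real.exp_pos _).le
  set v : ι → Fin n → ℝ := fun j k => ∫ y, s j k y ^ 2 ∂(P k) with hv
  have hv4 : ∀ j k, |v j k| ≤ 4 := fun j k => by
    have := norm_integral_le_of_norm_le_const (μ := P k) (C := 4)
      (f := fun y => s j k y ^ 2) (ae_of_all _ fun y => by
        rw [Real.norm_eq_abs, abs_of_nonneg (sq_nonneg _), ← sq_abs]
        nlinarith [hb j k y, abs_nonneg (s j k y)])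
    simpa using this
  have hvm : ∀ k, Measurable fun x => v (τ x) k := fun k =>
    (measurable_of_countable fun j => v j k).comp hτ
  have hsm : ∀ k, Measurable fun x : ∀ i, 𝒳 i => s (τ x) k (x k) := fun k =>
    (show Measurable fun p : ι × 𝒳 k => s p.1 k p.2 from
      measurable_from_prod_countable_right fun j => hs j k).comp
        (hτ.prodMk (measurable_pi_apply k))
  set R : Fin n → (∀ i, 𝒳 i) → ℝ := fun k x =>
    f x * (4 * t ^ 2 * v (τ x) k + 4 * t ^ 2 * s (τ x) k (x k)) with hR
  have hRm : ∀ k, Measurable (R k) := fun k =>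
    hfm.mul (((hvm k).const_mul _).add ((hsm k).const_mul _))
  have hRB : ∀ k x, |R k x| ≤ Real.exp (2 * n) * (4 * t ^ 2 * 4 + 4 * t ^ 2 * 2) := fun k x => by
    rw [abs_mul]
    refine mul_le_mul (hfB x) ((abs_add_le _ _).trans ?_) (abs_nonneg _) (Real.exp_pos _).le
    rw [abs_mul (4 * t ^ 2), abs_mul (4 * t ^ 2), abs_of_nonneg (by positivity : 0 ≤ 4 * t ^ 2)]
    exact add_le_add (mul_le_mul_of_nonneg_left (hv4 _ _) (by positivity))
      (mul_le_mul_of_nonneg_left (hb _ _ _) (by positivity))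
  -- The contribution of each coordinate, the others being fixed.
  have hstep : ∀ k, ∫ x, f x * L k x ∂(Measure.pi P) ≤ ∫ x, R k x ∂(Measure.pi P) := by
    intro k
    have hfLB : ∀ x, |f x * L k x| ≤ Real.exp (2 * n) * (4 * n) := fun x => by
      rw [abs_mul]; exact mul_le_mul (hfB x) (hLB k x) (abs_nonneg _) (Real.exp_pos _).le
    rw [← integral_integral_update P k (hfLm k) hfLB,
      ← integral_integral_update P k (hRm k) (hRB k)]
    have hint : ∀ {h : (∀ i, 𝒳 i) → ℝ}, Measurable h → ∀ {C : ℝ}, (∀ x, |h x| ≤ C) →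
        Integrable (fun x => ∫ z, h (Function.update x k z) ∂(P k)) (Measure.pi P) := by
      intro h hh C hC
      refine integrable_of_abs_le
        (measurable_integral_prod (P k) (hh.comp measurable_update')) (C := C) fun x => ?_
      have := norm_integral_le_of_norm_le_const (μ := P k) (C := C)
        (f := fun z => h (Function.update x k z)) (ae_of_all _ fun z => hC _)
      simpa using this
    refine integral_mono (hint (hfLm k) hfLB) (hint (hRm k) (hRB k)) fun x => ?_
    set a : ι → ℝ := fun j => ∑ i ∈ Finset.univ.erase k, s j i (x i)
    have hsum : ∀ j z, ∑ i, s j i (Function.update x k z i) = a j + s j k z := by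
      intro j z
      rw [← Finset.sum_erase_add _ _ (Finset.mem_univ k), Function.update_self]
      congr 1
      refine Finset.sum_congr rfl fun i hi => ?_
      rw [Function.update_of_ne (Finset.ne_of_mem_erase hi)]
    have haB : ∀ j, |a j| ≤ 2 * n := by
      intro j
      calc |a j| ≤ ∑ i ∈ Finset.univ.erase k, |s j i (x i)| := Finset.abs_sum_le_sum_abs _ _
        _ ≤ ∑ i, |s j i (x i)| := Finset.sum_le_univ_sum_of_nonneg fun _ => abs_nonneg _
        _ ≤ ∑ _i : Fin n, 2 := Finset.sum_le_sum fun k _ => hb _ _ _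
        _ = 2 * n := by simp [mul_comm]
    have hZu : ∀ z, Z (Function.update x k z) =
        a (τ (Function.update x k z)) + s (τ (Function.update x k z)) k z := fun z => by
      rw [hZ, hsum]
    have hup : Measurable fun z => Function.update x k z := measurable_update x
    have hAk : ∀ z, prefixMean P f k (Function.update x k z) = prefixMean P f k x :=
      prefixMean_update_self k x
    set r : 𝒳 k → ℝ := fun z =>
      prefixMean P f (k + 1) (Function.update x k z) / prefixMean P f k x with hr
    have hLr : ∀ z, L k (Function.update x k z) = Real.log (r z) := fun z => by
      rw [hr, Real.log_div (hA0 _ _).ne' (hA0 _ _).ne', ← hAk z]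
    have hcoord : ∀ y z, f y ≤ Real.exp (4 * t) * f (Function.update y k z) := by
      intro y z
      simp only [hf]
      rw [← Real.exp_add]
      refine Real.exp_le_exp.2 ?_
      have h1 := hmax (Function.update y k z) (τ y)
      rw [← hZ] at h1
      have h2 : Z y = ∑ i, s (τ y) i (Function.update y k z i) - s (τ y) k z + s (τ y) k (y k) := by
        have h5 : ∑ i ∈ Finset.univ.erase k, s (τ y) i (Function.update y k z i) =
            ∑ i ∈ Finset.univ.erase k, s (τ y) i (y i) := Finset.sum_congr rfl fun i hi => by
          rw [Function.update_of_ne (Finset.ne_of_mem_erase hi)]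
        rw [hZ, ← Finset.sum_erase_add _ _ (Finset.mem_univ k),
          ← Finset.sum_erase_add _ (fun i => s (τ y) i (Function.update y k z i))
            (Finset.mem_univ k), Function.update_self, h5]
        ring
      have h3 := (abs_le.1 (hb (τ y) k z)).1
      have h4 := (abs_le.1 (hb (τ y) k (y k))).2
      nlinarith
    have key := integral_exp_mul_log_le (P k) (s := fun j => s j k) (fun j => hs j k)
      (fun j => hb j k) (fun j => h0 j k) haB (j := fun z => τ (Function.update x k z))
      (hτ.comp hup) (fun j z => by
        have := hmax (Function.update x k z) j
        rwa [hsum, hsum] at this)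
      (r := r) (((hAm (k + 1)).comp hup).div_const _) (fun z => div_pos (hA0 _ _) (hA0 _ _))
      (B := 4 * n) (fun z => by rw [← hLr]; exact hLB _ _) (by
        rw [integral_div, integral_prefixMean_succ_update hfm hfB, div_self (hA0 _ _).ne'])
      ht0 ht (fun z => by
        rw [Real.log_le_iff_le_exp (div_pos (hA0 _ _) (hA0 _ _)), div_le_iff₀ (hA0 _ _)]
        have := prefixMean_succ_le (P := P) hfm hfB hcoord (Function.update x k z)
        rwa [hAk] at this)
    simpa only [hR, hf, hZu, hLr, hv, Function.update_self] using key
  have hfi : Integrable f (Measure.pi P) := integrable_of_abs_le hfm hfB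
  have hZfi : Integrable (fun x => Z x * f x) (Measure.pi P) :=
    integrable_of_abs_le (hZm.mul hfm) (C := 2 * n * Real.exp (2 * n)) fun x => by
      rw [abs_mul]; exact mul_le_mul (hZB x) (hfB x) (abs_nonneg _) (by positivity)
  have hRi : ∀ k, Integrable (R k) (Measure.pi P) := fun k =>
    integrable_of_abs_le (hRm k) (hRB k)
  have hleft : t * (∫ x, Z x * f x ∂(Measure.pi P)) -
      (∫ x, f x ∂(Measure.pi P)) * Real.log (∫ x, f x ∂(Measure.pi P)) =
      ∑ k, ∫ x, f x * L k x ∂(Measure.pi P) := by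
    rw [← integral_finsetSum _ fun k _ => hfLi k, ← integral_const_mul, ← integral_mul_const,
      ← integral_sub (hZfi.const_mul t) (hfi.mul_const _)]
    refine integral_congr_ae (ae_of_all _ fun x => ?_)
    dsimp only
    rw [← Finset.mul_sum, ← log_sub_log_integral]
    simp only [hf, Real.log_exp]
    ring
  have hright : ∑ k, ∫ x, R k x ∂(Measure.pi P) ≤
      4 * t ^ 2 * V * (∫ x, f x ∂(Measure.pi P)) +
        4 * t ^ 2 * ∫ x, Z x * f x ∂(Measure.pi P) := by
    rw [← integral_finsetSum _ fun k _ => hRi k, ← integral_const_mul, ← integral_const_mul,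
      ← integral_add (hfi.const_mul _) (hZfi.const_mul _)]
    refine integral_mono (integrable_finsetSum _ fun k _ => hRi k)
      ((hfi.const_mul _).add (hZfi.const_mul _)) fun x => ?_
    simp only [hR]
    rw [← Finset.mul_sum, Finset.sum_add_distrib, ← Finset.mul_sum, ← Finset.mul_sum, ← hZ]
    have h1 := mul_le_mul_of_nonneg_left (hV (τ x))
      (mul_nonneg (Real.exp_pos (t * Z x)).le (by positivity : 0 ≤ 4 * t ^ 2))
    simp only [hf, hv]
    linarith
  rw [hleft]
  exact (Finset.sum_le_sum fun k _ => hstep k).trans hright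

/-- Integration of the entropy bound: a bound on the Laplace transform that involves the variance
of each sum only, and not the sum of the largest variances. -/
lemma cgf_le (hs : ∀ j k, Measurable (s j k)) (hb : ∀ j k x, |s j k x| ≤ 2)
    (h0 : ∀ j k, ∫ y, s j k y ∂(P k) = 0) {V : ℝ} (hV : ∀ j, ∑ k, ∫ y, s j k y ^ 2 ∂(P k) ≤ V)
    (hτ : Measurable τ) (hmax : ∀ x j, ∑ k, s j k (x k) ≤ ∑ k, s (τ x) k (x k))
    {t : ℝ} (ht0 : 0 < t) (ht : t ≤ 1 / 8) {Z : (∀ i, 𝒳 i) → ℝ}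
    (hZ : ∀ x, Z x = ∑ k, s (τ x) k (x k)) :
    ProbabilityTheory.cgf Z (Measure.pi P) t * (1 / t - 4) ≤
      (∫ x, Z x ∂(Measure.pi P)) + 4 * V * t := by
  have hZm : Measurable Z := by
    rw [funext hZ]; exact measurable_sum_argmax hs hτ
  have hZB : ∀ x, |Z x| ≤ 2 * n := fun x => by rw [hZ]; exact abs_sum_le_two_mul hb _ _
  have hint : ∀ u, Integrable (fun x => Real.exp (u * Z x)) (Measure.pi P) := fun u =>
    integrable_of_abs_le (Real.measurable_exp.comp (hZm.const_mul u))
      (C := Real.exp (|u| * (2 * n))) fun x => by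
        rw [abs_of_pos (Real.exp_pos _)]
        refine Real.exp_le_exp.2 ((le_abs_self _).trans ?_)
        rw [abs_mul]
        exact mul_le_mul_of_nonneg_left (hZB x) (abs_nonneg _)
  have hset : ∀ u, u ∈ interior (ProbabilityTheory.integrableExpSet Z (Measure.pi P)) := by
    intro u
    have : ProbabilityTheory.integrableExpSet Z (Measure.pi P) = Set.univ :=
      Set.eq_univ_of_forall hint
    rw [this]; simp
  set F : ℝ → ℝ := ProbabilityTheory.mgf Z (Measure.pi P) with hF
  set L : ℝ → ℝ := ProbabilityTheory.cgf Z (Measure.pi P)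
  have hFpos : ∀ u, 0 < F u := fun u => ProbabilityTheory.mgf_pos (hint u)
  have hLd : ∀ u, HasDerivAt L
      ((∫ x, Z x * Real.exp (u * Z x) ∂(Measure.pi P)) / F u) u := fun u => by
    have := (ProbabilityTheory.hasDerivAt_mgf (hset u)).log (hFpos u).ne'
    exact this
  have hL0 : L 0 = 0 := ProbabilityTheory.cgf_zero
  -- The entropy bound is `u L'(u) - L(u) ≤ 4 u² V + 4 u² L'(u)`, that is `Φ' ≤ 0`; at zero `Φ`
  -- tends to `L'(0)`, the mean of `Z`.
  set Φ : ℝ → ℝ := fun u => L u / u - 4 * L u - 4 * V * u with hΦ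
  have hΦd : ∀ u, 0 < u → HasDerivAt Φ
      ((((∫ x, Z x * Real.exp (u * Z x) ∂(Measure.pi P)) / F u) * u - L u * 1) / u ^ 2 -
        4 * ((∫ x, Z x * Real.exp (u * Z x) ∂(Measure.pi P)) / F u) - 4 * V * 1) u := fun u hu =>
    (((hLd u).div (hasDerivAt_id u) hu.ne').sub ((hLd u).const_mul 4)).sub
      ((hasDerivAt_id u).const_mul (4 * V))
  have hanti : AntitoneOn Φ (Set.Ioc 0 t) := by
    refine antitoneOn_of_deriv_nonpos (convex_Ioc 0 t)
      (fun u hu => (hΦd u hu.1).continuousAt.continuousWithinAt)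
      (fun u hu => (hΦd u (interior_subset hu).1).differentiableAt.differentiableWithinAt) ?_
    intro u hu
    have hu' := interior_subset hu
    rw [(hΦd u hu'.1).deriv]
    have key := entropy_exp_le hs hb h0 hV hτ hmax hu'.1.le (hu'.2.trans ht) hZ
    set I := ∫ x, Z x * Real.exp (u * Z x) ∂(Measure.pi P)
    have hFu : ∫ x, Real.exp (u * Z x) ∂(Measure.pi P) = F u := rfl
    have hLu : Real.log (F u) = L u := rfl
    rw [hFu, hLu] at key
    have h1 : I = I / F u * F u := (div_mul_cancel₀ _ (hFpos u).ne').symm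
    set J := I / F u
    have h2 : u * J - L u ≤ 4 * u ^ 2 * V + 4 * u ^ 2 * J := by
      rw [h1] at key
      refine le_of_mul_le_mul_right ?_ (hFpos u)
      linarith
    have h3 : (J * u - L u * 1) / u ^ 2 ≤ 4 * V + 4 * J := by
      rw [div_le_iff₀ (by have := hu'.1; positivity)]
      linarith
    linarith
  have hlim : Filter.Tendsto Φ (nhdsWithin 0 (Set.Ioi 0))
      (nhds ((∫ x, Z x ∂(Measure.pi P)) - 4 * 0 - 4 * V * 0)) := by
    have hF0 : F 0 = 1 := by simp [hF]
    have hd := hLd 0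
    simp only [zero_mul, Real.exp_zero, mul_one, hF0, div_one] at hd
    have h1 : Filter.Tendsto (fun u => L u / u) (nhdsWithin 0 (Set.Ioi 0))
        (nhds (∫ x, Z x ∂(Measure.pi P))) := by
      have := hd.tendsto_slope.mono_left
        (nhdsWithin_mono 0 fun u (hu : 0 < u) => hu.ne')
      refine this.congr fun u => ?_
      rw [slope_def_field, hL0, sub_zero, sub_zero]
    have h2 : Filter.Tendsto L (nhdsWithin 0 (Set.Ioi 0)) (nhds 0) := by
      have := hd.continuousAt.tendsto.mono_left (nhdsWithin_le_nhds (s := Set.Ioi 0))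
      rwa [hL0] at this
    exact (h1.sub (h2.const_mul 4)).sub
      ((tendsto_nhdsWithin_of_tendsto_nhds Filter.tendsto_id).const_mul _)
  have hle : Φ t ≤ (∫ x, Z x ∂(Measure.pi P)) - 4 * 0 - 4 * V * 0 := by
    refine ge_of_tendsto hlim ?_
    filter_upwards [Ioc_mem_nhdsGT ht0] with u hu
    exact hanti hu ⟨ht0, le_rfl⟩ hu.2
  simp only [hΦ] at hle
  have : L t * (1 / t - 4) = L t / t - 4 * L t := by ring
  linarith

end Suprema

/-! ### Deviations of suprema of independent sums -/

lemma exists_measurable_argmax {Ω ι : Type*} [MeasurableSpace Ω] [Fintype ι] [Nonempty ι]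
    [MeasurableSpace ι] [DiscreteMeasurableSpace ι] {S : ι → Ω → ℝ} (hS : ∀ j, Measurable (S j)) :
    ∃ τ : Ω → ι, Measurable τ ∧ ∀ x j, S j x ≤ S (τ x) x := by
  classical
  suffices h : ∀ T : Finset ι, ∃ τ : Ω → ι, Measurable τ ∧ ∀ x, ∀ j ∈ T, S j x ≤ S (τ x) x by
    obtain ⟨τ, hτ, h⟩ := h Finset.univ
    exact ⟨τ, hτ, fun x j => h x j (Finset.mem_univ j)⟩
  intro T
  induction T using Finset.induction_on with
  | empty => exact ⟨fun _ => Classical.arbitrary ι, measurable_const, by simp⟩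
  | insert a T _ ih =>
    obtain ⟨τ, hτ, h⟩ := ih
    have hm : Measurable fun x => S (τ x) x :=
      (show Measurable fun p : ι × Ω => S p.1 p.2 from
        measurable_from_prod_countable_right hS).comp (hτ.prodMk measurable_id)
    refine ⟨fun x => if S (τ x) x ≤ S a x then a else τ x,
      Measurable.ite (measurableSet_le hm (hS a)) measurable_const hτ, fun x j hj => ?_⟩
    rcases Finset.mem_insert.1 hj with rfl | hj
    · dsimp only
      split_ifs with hx
      · exact le_rfl
      · exact (not_le.1 hx).le
    · dsimp only
      split_ifs with hx
      · exact (h x j hj).trans hx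
      · exact h x j hj

section Deviation

variable {n : ℕ} {𝒳 : Fin n → Type*} [∀ i, MeasurableSpace (𝒳 i)]
  {P : ∀ i, Measure (𝒳 i)} [∀ i, IsProbabilityMeasure (P i)]

/-- Deviations of the maximum of finitely many sums of independent centred variables. -/
lemma measure_exists_finite_abs_sum_gt_le {ι : Type*} [Fintype ι] [Nonempty ι]
    [MeasurableSpace ι] [DiscreteMeasurableSpace ι]
    {u : ι → ∀ k, 𝒳 k → ℝ} (hu : ∀ j k, Measurable (u j k))
    (hb : ∀ j k x, |u j k x| ≤ 2) (h0 : ∀ j k, ∫ y, u j k y ∂(P k) = 0) {V : ℝ}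
    (hV : ∀ j, ∑ k, ∫ y, u j k y ^ 2 ∂(P k) ≤ V) {g : (∀ i, 𝒳 i) → ℝ}
    (hg : Integrable g (Measure.pi P))
    (hgu : ∀ᵐ x ∂(Measure.pi P), ∀ j, |∑ k, u j k (x k)| ≤ g x) {t : ℝ} (ht0 : 0 < t)
    (ht : t ≤ 1 / 8) (ξ : ℝ) :
    Measure.pi P {x | ∃ j, 2 * (∫ x, g x ∂(Measure.pi P)) + 8 * V * t + ξ / t <
      |∑ k, u j k (x k)|} ≤ ENNReal.ofReal (Real.exp (-ξ)) := by
  -- Both signs are indexed, so that the maximum is that of the absolute values.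
  set s : ι × Bool → ∀ k, 𝒳 k → ℝ := fun p k x => if p.2 then u p.1 k x else -u p.1 k x with hs
  have hsm : ∀ p k, Measurable (s p k) := by
    rintro ⟨j, b⟩ k
    cases b
    · exact (hu j k).neg
    · exact hu j k
  have hsb : ∀ p k x, |s p k x| ≤ 2 := by
    rintro ⟨j, b⟩ k x
    cases b
    · simpa [hs] using hb j k x
    · simpa [hs] using hb j k x
  have hs0 : ∀ p k, ∫ y, s p k y ∂(P k) = 0 := by
    rintro ⟨j, b⟩ k
    cases b
    · simpa [hs, integral_neg] using h0 j k
    · simpa [hs] using h0 j k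
  have hsV : ∀ p, ∑ k, ∫ y, s p k y ^ 2 ∂(P k) ≤ V := by
    rintro ⟨j, b⟩
    cases b
    · simpa [hs] using hV j
    · simpa [hs] using hV j
  have hsum : ∀ (j : ι) (b : Bool) (x : ∀ i, 𝒳 i), ∑ k, s (j, b) k (x k) =
      if b then ∑ k, u j k (x k) else -∑ k, u j k (x k) := by
    intro j b x
    cases b <;> simp [hs]
  have hSm : ∀ p, Measurable fun x : ∀ i, 𝒳 i => ∑ k, s p k (x k) := fun p =>
    Finset.measurable_sum _ fun k _ => (hsm p k).comp (measurable_pi_apply k)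
  obtain ⟨τ, hτ, hmax⟩ := exists_measurable_argmax hSm
  set Z : (∀ i, 𝒳 i) → ℝ := fun x => ∑ k, s (τ x) k (x k) with hZ
  have hZm : Measurable Z := measurable_sum_argmax hsm hτ
  have hZB : ∀ x, |Z x| ≤ 2 * n := fun x => abs_sum_le_two_mul hsb _ _
  have hZi : Integrable Z (Measure.pi P) := integrable_of_abs_le hZm hZB
  have huZ : ∀ x j, |∑ k, u j k (x k)| ≤ Z x := by
    intro x j
    have h1 := hmax x (j, true)
    have h2 := hmax x (j, false)
    rw [hsum] at h1 h2
    exact abs_le.2 ⟨by simp at h2; linarith, by simpa using h1⟩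
  have hZ0 : ∀ x, 0 ≤ Z x := fun x => (abs_nonneg _).trans (huZ x (Classical.arbitrary ι))
  have hZg : ∀ᵐ x ∂(Measure.pi P), Z x ≤ g x := by
    filter_upwards [hgu] with x hx
    rcases hτx : τ x with ⟨j, b⟩
    have : Z x = if b then ∑ k, u j k (x k) else -∑ k, u j k (x k) := by
      rw [hZ]; dsimp only; rw [hτx, hsum]
    rw [this]
    have := abs_le.1 (hx j)
    split_ifs <;> linarith
  have hEZ : ∫ x, Z x ∂(Measure.pi P) ≤ ∫ x, g x ∂(Measure.pi P) := integral_mono_ae hZi hg hZg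
  have hEZ0 : 0 ≤ ∫ x, Z x ∂(Measure.pi P) := integral_nonneg hZ0
  have hV0 : 0 ≤ V :=
    (Finset.sum_nonneg fun k _ => integral_nonneg fun y => sq_nonneg _).trans
      (hV (Classical.arbitrary ι))
  have hcgf := cgf_le hsm hsb hs0 hsV hτ hmax ht0 ht (Z := Z) fun _ => rfl
  set w := ∫ x, g x ∂(Measure.pi P)
  have hL : ProbabilityTheory.cgf Z (Measure.pi P) t ≤ 2 * t * (w + 4 * V * t) := by
    have h1 : 1 / (2 * t) ≤ 1 / t - 4 := by
      have : 4 ≤ 1 / (2 * t) := by rw [le_div_iff₀ (by positivity)]; linarith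
      have h2 : 1 / t = 1 / (2 * t) + 1 / (2 * t) := by field_simp; norm_num
      linarith
    rcases le_or_gt (ProbabilityTheory.cgf Z (Measure.pi P) t) 0 with h | h
    · exact h.trans (by have := hEZ0.trans hEZ; positivity)
    · have h2 := mul_le_mul_of_nonneg_left h1 h.le
      have h3 : ProbabilityTheory.cgf Z (Measure.pi P) t * (1 / (2 * t)) ≤ w + 4 * V * t := by
        linarith
      rw [mul_one_div, div_le_iff₀ (by positivity)] at h3
      linarith
  have hexp : Integrable (fun x => Real.exp (t * Z x)) (Measure.pi P) :=
    integrable_of_abs_le (Real.measurable_exp.comp (hZm.const_mul t))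
      (C := Real.exp (t * (2 * n))) fun x => by
        rw [abs_of_pos (Real.exp_pos _)]
        exact Real.exp_le_exp.2 (mul_le_mul_of_nonneg_left ((le_abs_self _).trans (hZB x)) ht0.le)
  have hch := ProbabilityTheory.measure_ge_le_exp_cgf (μ := Measure.pi P) (X := Z)
    (2 * w + 8 * V * t + ξ / t) ht0.le hexp
  calc Measure.pi P {x | ∃ j, 2 * w + 8 * V * t + ξ / t < |∑ k, u j k (x k)|}
      ≤ Measure.pi P {x | 2 * w + 8 * V * t + ξ / t ≤ Z x} :=
        measure_mono fun x ⟨j, hj⟩ => hj.le.trans (huZ x j)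
    _ = ENNReal.ofReal ((Measure.pi P).real {x | 2 * w + 8 * V * t + ξ / t ≤ Z x}) :=
        (ofReal_measureReal (measure_ne_top _ _)).symm
    _ ≤ ENNReal.ofReal (Real.exp (-ξ)) := by
        refine ENNReal.ofReal_le_ofReal (hch.trans (Real.exp_le_exp.2 ?_))
        have : t * (ξ / t) = ξ := mul_div_cancel₀ _ ht0.ne'
        nlinarith

/-- A deviation inequality for the supremum of countably many sums of independent centred variables
that are bounded by two: apart from terms that involve the variances and the level `ξ`, the
supremum exceeds twice its mean with small probability only. -/
lemma measure_exists_abs_sum_gt_le {u : ℕ → ∀ k, 𝒳 k → ℝ} (hu : ∀ j k, Measurable (u j k))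
    (hb : ∀ j k x, |u j k x| ≤ 2) (h0 : ∀ j k, ∫ y, u j k y ∂(P k) = 0) {V : ℝ}
    (hV : ∀ j, ∑ k, ∫ y, u j k y ^ 2 ∂(P k) ≤ V) {g : (∀ i, 𝒳 i) → ℝ}
    (hg : Integrable g (Measure.pi P))
    (hgu : ∀ᵐ x ∂(Measure.pi P), ∀ j, |∑ k, u j k (x k)| ≤ g x) {t : ℝ} (ht0 : 0 < t)
    (ht : t ≤ 1 / 8) (ξ : ℝ) :
    Measure.pi P {x | ∃ j, 2 * (∫ x, g x ∂(Measure.pi P)) + 8 * V * t + ξ / t <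
      |∑ k, u j k (x k)|} ≤ ENNReal.ofReal (Real.exp (-ξ)) := by
  set b := 2 * (∫ x, g x ∂(Measure.pi P)) + 8 * V * t + ξ / t
  have hU : {x : ∀ i, 𝒳 i | ∃ j, b < |∑ k, u j k (x k)|} =
      ⋃ N : ℕ, {x | ∃ j : Fin (N + 1), b < |∑ k, u j k (x k)|} := by
    ext x
    simp only [Set.mem_ofPred_eq, Set.mem_iUnion]
    exact ⟨fun ⟨j, hj⟩ => ⟨j, ⟨j, j.lt_succ_self⟩, hj⟩, fun ⟨_, j, hj⟩ => ⟨j, hj⟩⟩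
  have hmono : Monotone fun N : ℕ =>
      {x : ∀ i, 𝒳 i | ∃ j : Fin (N + 1), b < |∑ k, u j k (x k)|} := by
    rintro N N' hN x ⟨j, hj⟩
    exact ⟨⟨j, by omega⟩, hj⟩
  rw [hU, hmono.measure_iUnion]
  exact iSup_le fun N => measure_exists_finite_abs_sum_gt_le (u := fun j : Fin (N + 1) => u j)
    (fun j => hu j) (fun j => hb j) (fun j => h0 j) (fun j => hV j) hg
    (hgu.mono fun x hx j => hx j) ht0 ht ξ

end Deviation

/-! ### The Hellinger distance -/

section Hellinger

variable {Ω : Type*} [MeasurableSpace Ω] {P Q R ν : Measure Ω}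

lemma hellingerSq_nonneg : 0 ≤ hellingerSq P Q :=
  mul_nonneg (by norm_num) (integral_nonneg fun _ => sq_nonneg _)

lemma hellingerSq_self : hellingerSq P P = 0 := by simp [hellingerSq]

lemma hellingerSq_comm : hellingerSq P Q = hellingerSq Q P := by
  unfold hellingerSq
  rw [add_comm P Q]
  congr 2
  ext x
  ring

/-- The square root of the density of `P` with respect to `ν`. -/
noncomputable def sqrtDensity (P ν : Measure Ω) (x : Ω) : ℝ := √((P.rnDeriv ν x).toReal)

lemma measurable_sqrtDensity : Measurable (sqrtDensity P ν) :=
  (P.measurable_rnDeriv ν).ennreal_toReal.sqrt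

lemma sqrtDensity_nonneg (x : Ω) : 0 ≤ sqrtDensity P ν x := Real.sqrt_nonneg _

lemma sqrtDensity_sq (x : Ω) : sqrtDensity P ν x ^ 2 = (P.rnDeriv ν x).toReal :=
  Real.sq_sqrt ENNReal.toReal_nonneg

variable [IsFiniteMeasure P] [IsFiniteMeasure Q]

lemma integrable_sq_sqrtDensity_sub :
    Integrable (fun x => (sqrtDensity P ν x - sqrtDensity Q ν x) ^ 2) ν := by
  refine Integrable.mono' ((Measure.integrable_toReal_rnDeriv (μ := P) (ν := ν)).add
    (Measure.integrable_toReal_rnDeriv (μ := Q) (ν := ν)))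
    ((measurable_sqrtDensity.sub measurable_sqrtDensity).pow_const 2).aestronglyMeasurable
    (ae_of_all _ fun x => ?_)
  rw [Real.norm_eq_abs, abs_of_nonneg (sq_nonneg _), Pi.add_apply, ← sqrtDensity_sq,
    ← sqrtDensity_sq]
  nlinarith [sqrtDensity_nonneg (P := P) (ν := ν) x, sqrtDensity_nonneg (P := Q) (ν := ν) x,
    mul_nonneg (sqrtDensity_nonneg (P := P) (ν := ν) x) (sqrtDensity_nonneg (P := Q) (ν := ν) x)]

/-- The squared Hellinger distance may be computed with any dominating measure. -/
lemma hellingerSq_eq [IsFiniteMeasure ν] (hP : P ≪ ν) (hQ : Q ≪ ν) :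
    hellingerSq P Q = (1 / 2) * ∫ x, (sqrtDensity P ν x - sqrtDensity Q ν x) ^ 2 ∂ν := by
  have hS : P + Q ≪ ν := Measure.AbsolutelyContinuous.add_left hP hQ
  have hPS : P ≪ P + Q := rfl.absolutelyContinuous.add_right _
  have hQS : Q ≪ P + Q := rfl.absolutelyContinuous.add_right' _
  unfold hellingerSq
  rw [← integral_toReal_rnDeriv_mul hS]
  congr 1
  refine integral_congr_ae ?_
  filter_upwards [Measure.rnDeriv_mul_rnDeriv (κ := ν) hPS,
    Measure.rnDeriv_mul_rnDeriv (κ := ν) hQS] with x h1 h2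
  simp only [sqrtDensity, ← h1, ← h2, Pi.mul_apply, ENNReal.toReal_mul]
  rw [Real.sqrt_mul ENNReal.toReal_nonneg, Real.sqrt_mul ENNReal.toReal_nonneg]
  set c := ((P + Q).rnDeriv ν x).toReal
  have : √c ^ 2 = c := Real.sq_sqrt ENNReal.toReal_nonneg
  linear_combination
    (-(√((P.rnDeriv (P + Q) x).toReal) - √((Q.rnDeriv (P + Q) x).toReal)) ^ 2) * this

/-- The triangle inequality of the Hellinger distance, in squared form. -/
lemma hellingerSq_le_add [IsFiniteMeasure R] {ε : ℝ} (hε : 0 < ε) :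
    hellingerSq P R ≤ (1 + ε) * hellingerSq P Q + (1 + ε⁻¹) * hellingerSq Q R := by
  set ν := P + Q + R
  have hP : P ≪ ν := (rfl.absolutelyContinuous.add_right _).add_right _
  have hQ : Q ≪ ν := (rfl.absolutelyContinuous.add_right' _).add_right _
  have hR : R ≪ ν := rfl.absolutelyContinuous.add_right' _
  rw [hellingerSq_eq hP hR, hellingerSq_eq hP hQ, hellingerSq_eq hQ hR]
  have : ∫ x, (sqrtDensity P ν x - sqrtDensity R ν x) ^ 2 ∂ν ≤
      ∫ x, ((1 + ε) * (sqrtDensity P ν x - sqrtDensity Q ν x) ^ 2 +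
        (1 + ε⁻¹) * (sqrtDensity Q ν x - sqrtDensity R ν x) ^ 2) ∂ν := by
    refine integral_mono integrable_sq_sqrtDensity_sub
      ((integrable_sq_sqrtDensity_sub.const_mul _).add
        (integrable_sq_sqrtDensity_sub.const_mul _)) fun x => ?_
    dsimp only
    set a := sqrtDensity P ν x - sqrtDensity Q ν x
    set b := sqrtDensity Q ν x - sqrtDensity R ν x
    have h1 : sqrtDensity P ν x - sqrtDensity R ν x = a + b := by ring
    have h2 : ε * ε⁻¹ = 1 := mul_inv_cancel₀ hε.ne'
    have h3 : 0 ≤ ε * (a - ε⁻¹ * b) ^ 2 := by positivity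
    have h4 : ε * (a - ε⁻¹ * b) ^ 2 = ε * a ^ 2 - 2 * a * b + ε⁻¹ * b ^ 2 := by
      linear_combination (-2 * a * b + ε⁻¹ * b ^ 2) * h2
    rw [h1]
    linarith
  rw [integral_add (integrable_sq_sqrtDensity_sub.const_mul _)
    (integrable_sq_sqrtDensity_sub.const_mul _), integral_const_mul, integral_const_mul] at this
  linarith

/-- Second moments under two laws, compared through the Hellinger distance. -/
lemma integral_sq_le_add_hellingerSq {φ : Ω → ℝ} (hφ : Measurable φ) (hφ1 : ∀ x, |φ x| ≤ 1) :
    ∫ x, φ x ^ 2 ∂P ≤ 2 * (∫ x, φ x ^ 2 ∂Q) + 4 * hellingerSq P Q := by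
  have hP : P ≪ P + Q := rfl.absolutelyContinuous.add_right _
  have hQ : Q ≪ P + Q := rfl.absolutelyContinuous.add_right' _
  have hφ2 : ∀ x, |φ x ^ 2| ≤ 1 := fun x => by
    rw [abs_of_nonneg (sq_nonneg _), ← sq_abs]
    nlinarith [hφ1 x, abs_nonneg (φ x)]
  have hi : ∀ S : Measure Ω, IsFiniteMeasure S → Integrable (fun x => φ x ^ 2) S := fun S _ =>
    integrable_of_abs_le (hφ.pow_const 2) hφ2
  rw [hellingerSq_eq hP hQ, ← integral_toReal_rnDeriv_mul hP, ← integral_toReal_rnDeriv_mul hQ]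
  have hiP := (integrable_toReal_rnDeriv_mul_iff hP).2 (hi P inferInstance)
  have hiQ := (integrable_toReal_rnDeriv_mul_iff hQ).2 (hi Q inferInstance)
  have : ∫ x, (P.rnDeriv (P + Q) x).toReal * φ x ^ 2 ∂(P + Q) ≤
      ∫ x, (2 * ((Q.rnDeriv (P + Q) x).toReal * φ x ^ 2) +
        2 * (sqrtDensity P (P + Q) x - sqrtDensity Q (P + Q) x) ^ 2) ∂(P + Q) := by
    refine integral_mono hiP
      ((hiQ.const_mul 2).add (integrable_sq_sqrtDensity_sub.const_mul 2)) fun x => ?_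
    dsimp only
    rw [← sqrtDensity_sq, ← sqrtDensity_sq]
    set p := sqrtDensity P (P + Q) x
    set r := sqrtDensity Q (P + Q) x
    have h1 := (abs_le.1 (hφ2 x)).2
    have h2 : p ^ 2 ≤ 2 * r ^ 2 + 2 * (p - r) ^ 2 := by nlinarith [sq_nonneg (p - 2 * r)]
    nlinarith [mul_le_mul_of_nonneg_right h2 (sq_nonneg (φ x)),
      mul_le_mul_of_nonneg_left h1 (sq_nonneg (p - r))]
  rw [integral_add (hiQ.const_mul 2) (integrable_sq_sqrtDensity_sub.const_mul 2),
    integral_const_mul, integral_const_mul] at this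
  linarith

/-- Means under two laws, compared through the Hellinger distance. -/
lemma integral_le_add_hellingerSq {φ : Ω → ℝ} (hφ : Measurable φ) (hφ1 : ∀ x, |φ x| ≤ 1)
    {η : ℝ} (hη : 0 < η) :
    ∫ x, φ x ∂P ≤ (∫ x, φ x ∂Q) + η * (∫ x, φ x ^ 2 ∂Q) +
      2 * (1 + η⁻¹) * hellingerSq P Q := by
  have hP : P ≪ P + Q := rfl.absolutelyContinuous.add_right _
  have hQ : Q ≪ P + Q := rfl.absolutelyContinuous.add_right' _
  have hφ2 : ∀ x, |φ x ^ 2| ≤ 1 := fun x => by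
    rw [abs_of_nonneg (sq_nonneg _), ← sq_abs]
    nlinarith [hφ1 x, abs_nonneg (φ x)]
  rw [hellingerSq_eq hP hQ, ← integral_toReal_rnDeriv_mul hP, ← integral_toReal_rnDeriv_mul hQ,
    ← integral_toReal_rnDeriv_mul hQ]
  have hiP := (integrable_toReal_rnDeriv_mul_iff hP).2 (integrable_of_abs_le (ν := P) hφ hφ1)
  have hiQ := (integrable_toReal_rnDeriv_mul_iff hQ).2 (integrable_of_abs_le (ν := Q) hφ hφ1)
  have hiQ2 := (integrable_toReal_rnDeriv_mul_iff hQ).2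
    (integrable_of_abs_le (ν := Q) (hφ.pow_const 2) hφ2)
  have : ∫ x, (P.rnDeriv (P + Q) x).toReal * φ x ∂(P + Q) ≤
      ∫ x, ((Q.rnDeriv (P + Q) x).toReal * φ x + η * ((Q.rnDeriv (P + Q) x).toReal * φ x ^ 2) +
        (1 + η⁻¹) * (sqrtDensity P (P + Q) x - sqrtDensity Q (P + Q) x) ^ 2) ∂(P + Q) := by
    refine integral_mono hiP ((hiQ.add (hiQ2.const_mul η)).add
      (integrable_sq_sqrtDensity_sub.const_mul _)) fun x => ?_
    dsimp only
    rw [← sqrtDensity_sq, ← sqrtDensity_sq]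
    set p := sqrtDensity P (P + Q) x
    set r := sqrtDensity Q (P + Q) x
    have h1 : φ x * (p - r) ^ 2 ≤ (p - r) ^ 2 :=
      mul_le_of_le_one_left (sq_nonneg _) (abs_le.1 (hφ1 x)).2
    have h2 : η * η⁻¹ = 1 := mul_inv_cancel₀ hη.ne'
    have h3 : 0 ≤ η * (φ x * r - η⁻¹ * (p - r)) ^ 2 := by positivity
    have h4 : η * (φ x * r - η⁻¹ * (p - r)) ^ 2 =
        η * (φ x * r) ^ 2 - 2 * (φ x * r) * (p - r) + η⁻¹ * (p - r) ^ 2 := by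
      linear_combination (-2 * (φ x * r) * (p - r) + η⁻¹ * (p - r) ^ 2) * h2
    nlinarith
  have hiQ3 : Integrable (fun x => (Q.rnDeriv (P + Q) x).toReal * φ x +
      η * ((Q.rnDeriv (P + Q) x).toReal * φ x ^ 2)) (P + Q) := hiQ.add (hiQ2.const_mul η)
  rw [integral_add hiQ3 (integrable_sq_sqrtDensity_sub.const_mul _),
    integral_add hiQ (hiQ2.const_mul η), integral_const_mul, integral_const_mul] at this
  linarith

end Hellinger

lemma hellingerSq_le_one {Ω : Type*} [MeasurableSpace Ω] {P Q : Measure Ω}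
    [IsProbabilityMeasure P] [IsProbabilityMeasure Q] :
    hellingerSq P Q ≤ 1 := by
  have hPS : P ≪ P + Q := rfl.absolutelyContinuous.add_right _
  have hQS : Q ≪ P + Q := rfl.absolutelyContinuous.add_right' _
  rw [hellingerSq_eq hPS hQS]
  have : ∫ x, (sqrtDensity P (P + Q) x - sqrtDensity Q (P + Q) x) ^ 2 ∂(P + Q) ≤
      ∫ x, ((P.rnDeriv (P + Q) x).toReal + (Q.rnDeriv (P + Q) x).toReal) ∂(P + Q) := by
    refine integral_mono integrable_sq_sqrtDensity_sub
      (Measure.integrable_toReal_rnDeriv.add Measure.integrable_toReal_rnDeriv) fun x => ?_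
    dsimp only
    rw [← sqrtDensity_sq, ← sqrtDensity_sq]
    nlinarith [mul_nonneg (sqrtDensity_nonneg (P := P) (ν := P + Q) x)
      (sqrtDensity_nonneg (P := Q) (ν := P + Q) x)]
  rw [integral_add Measure.integrable_toReal_rnDeriv Measure.integrable_toReal_rnDeriv,
    Measure.integral_toReal_rnDeriv hPS, Measure.integral_toReal_rnDeriv hQS] at this
  simp only [probReal_univ] at this
  linarith


section Loss

variable {n : ℕ} {𝒳 : Fin n → Type*} [∀ i, MeasurableSpace (𝒳 i)] {P Q R : ∀ i, Measure (𝒳 i)}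

lemma lossSq_nonneg : 0 ≤ lossSq P Q := Finset.sum_nonneg fun _ _ => hellingerSq_nonneg

lemma lossSq_comm : lossSq P Q = lossSq Q P := Finset.sum_congr rfl fun _ _ => hellingerSq_comm

lemma lossSq_le_natCast [∀ i, IsProbabilityMeasure (P i)] [∀ i, IsProbabilityMeasure (Q i)] :
    lossSq P Q ≤ n := by
  calc lossSq P Q ≤ ∑ _i : Fin n, (1 : ℝ) := Finset.sum_le_sum fun _ _ => hellingerSq_le_one
    _ = n := by simp

lemma lossSq_le_add [∀ i, IsFiniteMeasure (P i)] [∀ i, IsFiniteMeasure (Q i)]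
    [∀ i, IsFiniteMeasure (R i)] {ε : ℝ} (hε : 0 < ε) :
    lossSq P R ≤ (1 + ε) * lossSq P Q + (1 + ε⁻¹) * lossSq Q R := by
  unfold lossSq
  rw [Finset.mul_sum, Finset.mul_sum, ← Finset.sum_add_distrib]
  exact Finset.sum_le_sum fun _ _ => hellingerSq_le_add hε

end Loss

/-! ### The statistic and its centred version -/

section Statistic

variable {ψ : ℝ≥0∞ → ℝ}

lemma IsRhoFunction.map_top (hψ : IsRhoFunction ψ) : ψ ⊤ = 1 := by
  have := hψ.map_inv 0
  rw [ENNReal.inv_zero, hψ.map_zero] at this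
  linarith

lemma IsRhoFunction.abs_le_one (hψ : IsRhoFunction ψ) (x : ℝ≥0∞) : |ψ x| ≤ 1 := by
  refine abs_le.2 ⟨?_, ?_⟩
  · rw [← hψ.map_zero]; exact hψ.strictMono.monotone bot_le
  · rw [← hψ.map_top]; exact hψ.strictMono.monotone le_top

lemma ratio_swap (a b : ℝ≥0) : ratio a b = (ratio b a)⁻¹ := by
  unfold ratio
  by_cases h : a = 0 ∧ b = 0
  · simp [h]
  · rw [if_neg h, if_neg fun h' => h ⟨h'.2, h'.1⟩]
    rw [ENNReal.inv_div]
    · exact Or.inl ENNReal.coe_ne_top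
    · by_contra h'
      push Not at h'
      exact h ⟨by simpa using h'.1, by simpa using h'.2⟩

lemma measurable_ratio : Measurable fun p : ℝ≥0 × ℝ≥0 => ratio p.1 p.2 := by
  unfold ratio
  refine Measurable.ite ?_ measurable_const (by fun_prop)
  exact (measurable_fst (measurableSet_singleton 0)).inter
    (measurable_snd (measurableSet_singleton 0))

variable {n : ℕ} {𝒳 : Fin n → Type*}

lemma abs_psiRatio_le_one (hψ : IsRhoFunction ψ) (q q' : ∀ i, 𝒳 i → ℝ≥0) (i : Fin n) (x : 𝒳 i) :
    |psiRatio ψ q q' i x| ≤ 1 := hψ.abs_le_one _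

lemma psiRatio_swap (hψ : IsRhoFunction ψ) (q q' : ∀ i, 𝒳 i → ℝ≥0) (i : Fin n) (x : 𝒳 i) :
    psiRatio ψ q' q i x = -psiRatio ψ q q' i x := by
  unfold psiRatio
  rw [ratio_swap, ENNReal.inv_rpow, hψ.map_inv]

lemma stat_swap (hψ : IsRhoFunction ψ) (x : ∀ i, 𝒳 i) (q q' : ∀ i, 𝒳 i → ℝ≥0) :
    stat ψ x q' q = -stat ψ x q q' := by
  unfold stat
  rw [← Finset.sum_neg_distrib]
  exact Finset.sum_congr rfl fun i _ => psiRatio_swap hψ q q' i (x i)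

lemma abs_stat_le (hψ : IsRhoFunction ψ) (x : ∀ i, 𝒳 i) (q q' : ∀ i, 𝒳 i → ℝ≥0) :
    |stat ψ x q q'| ≤ n := by
  calc |stat ψ x q q'| ≤ ∑ i, |psiRatio ψ q q' i (x i)| := Finset.abs_sum_le_sum_abs _ _
    _ ≤ ∑ _i : Fin n, (1 : ℝ) := Finset.sum_le_sum fun i _ => abs_psiRatio_le_one hψ _ _ _ _
    _ = n := by simp

variable [∀ i, MeasurableSpace (𝒳 i)]

lemma measurable_psiRatio (hψ : IsRhoFunction ψ) {q q' : ∀ i, 𝒳 i → ℝ≥0} {i : Fin n}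
    (hq : Measurable (q i)) (hq' : Measurable (q' i)) : Measurable (psiRatio ψ q q' i) :=
  hψ.continuous.measurable.comp
    ((measurable_ratio.comp (hq'.prodMk hq)).pow_const (1 / 2 : ℝ))

variable {P : ∀ i, Measure (𝒳 i)}

/-- The terms of the centred statistic. -/
noncomputable def centredPsi (ψ : ℝ≥0∞ → ℝ) (P : ∀ i, Measure (𝒳 i)) (q q' : ∀ i, 𝒳 i → ℝ≥0)
    (i : Fin n) (x : 𝒳 i) : ℝ :=
  psiRatio ψ q q' i x - ∫ y, psiRatio ψ q q' i y ∂(P i)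

lemma measurable_centredPsi (hψ : IsRhoFunction ψ) {q q' : ∀ i, 𝒳 i → ℝ≥0} {i : Fin n}
    (hq : Measurable (q i)) (hq' : Measurable (q' i)) : Measurable (centredPsi ψ P q q' i) :=
  (measurable_psiRatio hψ hq hq').sub_const _

variable [∀ i, IsProbabilityMeasure (P i)]

lemma integral_stat (hψ : IsRhoFunction ψ) {q q' : ∀ i, 𝒳 i → ℝ≥0}
    (hq : ∀ i, Measurable (q i)) (hq' : ∀ i, Measurable (q' i)) :
    ∫ x, stat ψ x q q' ∂(Measure.pi P) = ∑ i, ∫ x, psiRatio ψ q q' i x ∂(P i) := by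
  unfold stat
  rw [integral_finsetSum]
  · exact Finset.sum_congr rfl fun i _ =>
      integral_comp_eval (measurable_psiRatio hψ (hq i) (hq' i)).aestronglyMeasurable
  · intro i _
    exact integrable_comp_eval (integrable_of_abs_le (measurable_psiRatio hψ (hq i) (hq' i))
      (abs_psiRatio_le_one hψ q q' i))

lemma centredStat_eq_sum (hψ : IsRhoFunction ψ) {q q' : ∀ i, 𝒳 i → ℝ≥0}
    (hq : ∀ i, Measurable (q i)) (hq' : ∀ i, Measurable (q' i)) (x : ∀ i, 𝒳 i) :
    centredStat ψ P x q q' = ∑ i, centredPsi ψ P q q' i (x i) := by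
  unfold centredStat centredPsi
  rw [integral_stat hψ hq hq', Finset.sum_sub_distrib]
  rfl

lemma abs_centredPsi_le_two (hψ : IsRhoFunction ψ) (q q' : ∀ i, 𝒳 i → ℝ≥0) (i : Fin n)
    (x : 𝒳 i) : |centredPsi ψ P q q' i x| ≤ 2 := by
  have h1 := abs_psiRatio_le_one hψ q q' i x
  have h2 := norm_integral_le_of_norm_le_const (μ := P i) (f := psiRatio ψ q q' i) (C := 1)
    (ae_of_all _ fun y => abs_psiRatio_le_one hψ q q' i y)
  have h3 : |∫ y, psiRatio ψ q q' i y ∂(P i)| ≤ 1 := by simpa using h2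
  unfold centredPsi
  have := abs_sub (psiRatio ψ q q' i x) (∫ y, psiRatio ψ q q' i y ∂(P i))
  linarith

lemma integral_centredPsi (hψ : IsRhoFunction ψ) {q q' : ∀ i, 𝒳 i → ℝ≥0} {i : Fin n}
    (hq : Measurable (q i)) (hq' : Measurable (q' i)) :
    ∫ x, centredPsi ψ P q q' i x ∂(P i) = 0 := by
  unfold centredPsi
  rw [integral_sub (integrable_of_abs_le (measurable_psiRatio hψ hq hq')
    (abs_psiRatio_le_one hψ q q' i)) (integrable_const _)]
  simp

lemma integral_centredPsi_sq_le (hψ : IsRhoFunction ψ) {q q' : ∀ i, 𝒳 i → ℝ≥0} {i : Fin n}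
    (hq : Measurable (q i)) (hq' : Measurable (q' i)) :
    ∫ x, centredPsi ψ P q q' i x ^ 2 ∂(P i) ≤ ∫ x, psiRatio ψ q q' i x ^ 2 ∂(P i) := by
  set m := ∫ y, psiRatio ψ q q' i y ∂(P i) with hm
  have hi : Integrable (psiRatio ψ q q' i) (P i) :=
    integrable_of_abs_le (measurable_psiRatio hψ hq hq') (abs_psiRatio_le_one hψ q q' i)
  have hi2 : Integrable (fun x => psiRatio ψ q q' i x ^ 2) (P i) :=
    integrable_of_abs_le ((measurable_psiRatio hψ hq hq').pow_const 2) (C := 1) fun x => by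
      rw [abs_of_nonneg (sq_nonneg _), ← sq_abs]
      nlinarith [abs_psiRatio_le_one hψ q q' i x, abs_nonneg (psiRatio ψ q q' i x)]
  have : ∀ x, centredPsi ψ P q q' i x ^ 2 =
      psiRatio ψ q q' i x ^ 2 - 2 * m * psiRatio ψ q q' i x + m ^ 2 := fun x => by
    unfold centredPsi; ring
  simp only [this]
  have hi3 : Integrable (fun x => psiRatio ψ q q' i x ^ 2 - 2 * m * psiRatio ψ q q' i x) (P i) :=
    hi2.sub (hi.const_mul _)
  rw [integral_add hi3 (integrable_const _), integral_sub hi2 (hi.const_mul _),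
    integral_const_mul, ← hm]
  simp
  nlinarith [sq_nonneg m]

end Statistic

/-! ### Moments of the statistic under the true law -/

section Moments

variable {n : ℕ} {𝒳 : Fin n → Type*} [∀ i, MeasurableSpace (𝒳 i)] {μ P : ∀ i, Measure (𝒳 i)}
  [∀ i, IsProbabilityMeasure (P i)] {ψ : ℝ≥0∞ → ℝ} {a₀ a₁ a₂ : ℝ} {𝒬 : Set (∀ i, 𝒳 i → ℝ≥0)}
  {p q : ∀ i, 𝒳 i → ℝ≥0}

/-- The coefficient of the approximation error in the bound for the mean of the statistic. -/
noncomputable def meanConst (a₁ a₂ : ℝ) : ℝ := 2 * (1 + (a₁ / (16 * a₂ ^ 2))⁻¹) + 15 * a₁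

/-- The moment inequalities hold under laws of the model only. Under the true law the mean of the
statistic is controlled by comparison with the law `p · μ`. -/
lemma integral_stat_le (ha₁ : 0 < a₁) (ha₂ : 1 ≤ a₂ ^ 2) (hψ : IsRhoFunction ψ)
    (hM : SatisfiesMoments a₀ a₁ a₂ ψ μ 𝒬) (hp : p ∈ 𝒬) (hq : q ∈ 𝒬)
    (hp' : IsProductDensity μ p) (hq' : IsProductDensity μ q) :
    ∫ x, stat ψ x p q ∂(Measure.pi P) ≤
      meanConst a₁ a₂ * lossSq P (law μ p) - 7 / 8 * a₁ * lossSq P (law μ q) := by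
  rw [integral_stat hψ (fun i => (hp' i).1) (fun i => (hq' i).1)]
  unfold lossSq
  rw [Finset.mul_sum, Finset.mul_sum, ← Finset.sum_sub_distrib]
  refine Finset.sum_le_sum fun i _ => ?_
  have : IsProbabilityMeasure (law μ p i) := (hp' i).2
  have : IsProbabilityMeasure (law μ q i) := (hq' i).2
  have hη : 0 < a₁ / (16 * a₂ ^ 2) := by positivity
  have h1 := integral_le_add_hellingerSq (P := P i) (Q := law μ p i)
    (measurable_psiRatio hψ (hp' i).1 (hq' i).1) (abs_psiRatio_le_one hψ p q i) hη
  have h2 := hM.mean p hp q hq p hp i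
  have h3 := hM.square p hp q hq p hp i
  -- The factor `1 + 1 / 14` turns the `15 / 16` left by the second moment into `7 / 8`.
  have h4 := hellingerSq_le_add (P := P i) (Q := law μ p i) (R := law μ q i)
    (ε := 14) (by norm_num)
  rw [hellingerSq_self] at h2 h3
  have h5 := mul_le_mul_of_nonneg_left h3 hη.le
  have h6 : a₁ / (16 * a₂ ^ 2) * (a₂ ^ 2 * (0 + hellingerSq (law μ p i) (law μ q i))) =
      a₁ / 16 * hellingerSq (law μ p i) (law μ q i) := by
    have : a₂ ^ 2 ≠ 0 := by positivity
    generalize a₂ ^ 2 = c at this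
    field_simp
    ring
  rw [h6] at h5
  have h7 := mul_le_mul_of_nonneg_left h4 ha₁.le
  have h8 := mul_nonneg ha₁.le (hellingerSq_nonneg (P := P i) (Q := law μ p i))
  norm_num at h7
  unfold meanConst
  linarith

lemma sum_integral_centredPsi_sq_le (ha₂ : 1 ≤ a₂ ^ 2) (hψ : IsRhoFunction ψ)
    (hM : SatisfiesMoments a₀ a₁ a₂ ψ μ 𝒬) (hp : p ∈ 𝒬) (hq : q ∈ 𝒬)
    (hp' : IsProductDensity μ p) (hq' : IsProductDensity μ q) :
    ∑ i, ∫ x, centredPsi ψ P p q i x ^ 2 ∂(P i) ≤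
      4 * (a₂ ^ 2 + 1) * (lossSq P (law μ p) + lossSq P (law μ q)) := by
  unfold lossSq
  rw [← Finset.sum_add_distrib, Finset.mul_sum]
  refine Finset.sum_le_sum fun i _ => ?_
  have : IsProbabilityMeasure (law μ p i) := (hp' i).2
  have : IsProbabilityMeasure (law μ q i) := (hq' i).2
  refine (integral_centredPsi_sq_le hψ (hp' i).1 (hq' i).1).trans ?_
  have h1 := integral_sq_le_add_hellingerSq (P := P i) (Q := law μ p i)
    (measurable_psiRatio hψ (hp' i).1 (hq' i).1) (abs_psiRatio_le_one hψ p q i)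
  have h3 := hM.square p hp q hq p hp i
  have h4 := hellingerSq_le_add (P := law μ p i) (Q := P i) (R := law μ q i) (ε := 1) one_pos
  rw [hellingerSq_comm (P := law μ p i) (Q := P i)] at h4
  rw [hellingerSq_self] at h3
  have h5 := mul_le_mul_of_nonneg_left h4 (by positivity : 0 ≤ a₂ ^ 2)
  have h6 := hellingerSq_nonneg (P := P i) (Q := law μ q i)
  norm_num at h5
  linarith

lemma abs_centredStat_le (hψ : IsRhoFunction ψ) (x : ∀ i, 𝒳 i) (p q : ∀ i, 𝒳 i → ℝ≥0) :
    |centredStat ψ P x p q| ≤ 2 * n := by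
  have h2 := norm_integral_le_of_norm_le_const (μ := Measure.pi P)
    (f := fun y => stat ψ y p q) (C := n) (ae_of_all _ fun y => abs_stat_le hψ y p q)
  have h3 : |∫ y, stat ψ y p q ∂(Measure.pi P)| ≤ n := by simpa using h2
  have := abs_sub (stat ψ x p q) (∫ y, stat ψ y p q ∂(Measure.pi P))
  unfold centredStat
  linarith [abs_stat_le hψ x p q]

lemma measurable_centredStat (hψ : IsRhoFunction ψ) (hp' : IsProductDensity μ p)
    (hq' : IsProductDensity μ q) : Measurable fun x => centredStat ψ P x p q := by
  simp only [centredStat_eq_sum hψ (fun i => (hp' i).1) (fun i => (hq' i).1)]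
  exact Finset.measurable_sum _ fun i _ =>
    (measurable_centredPsi hψ (hp' i).1 (hq' i).1).comp (measurable_pi_apply i)

end Moments

/-! ### Fluctuations of the process at a fixed scale -/

section Fluctuation

variable {n : ℕ} {𝒳 : Fin n → Type*} [∀ i, MeasurableSpace (𝒳 i)] {μ P : ∀ i, Measure (𝒳 i)}
  {ψ : ℝ≥0∞ → ℝ} {a₀ a₁ a₂ : ℝ} {𝒬 𝒬' S : Set (∀ i, 𝒳 i → ℝ≥0)}
  {p : ∀ i, 𝒳 i → ℝ≥0} {z : ℝ}

/-- The densities `q` of `𝒬` with `H²(P, p · μ) + H²(P, q · μ) < z`. -/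
def lossBall (μ P : ∀ i, Measure (𝒳 i)) (𝒬 : Set (∀ i, 𝒳 i → ℝ≥0)) (p : ∀ i, 𝒳 i → ℝ≥0)
    (z : ℝ) : Set (∀ i, 𝒳 i → ℝ≥0) :=
  {q | q ∈ 𝒬 ∧ lossSq P (law μ p) + lossSq P (law μ q) < z}

lemma fluctuation_eq_integral_iSup :
    fluctuation ψ μ P 𝒬 p z =
      ∫ x, ⨆ q : lossBall μ P 𝒬 p z, |centredStat ψ P x p q| ∂(Measure.pi P) := rfl

variable [∀ i, IsProbabilityMeasure (P i)]

lemma bddAbove_abs_centredStat (hψ : IsRhoFunction ψ) (x : ∀ i, 𝒳 i)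
    (B : Set (∀ i, 𝒳 i → ℝ≥0)) :
    BddAbove (Set.range fun q : B => |centredStat ψ P x p q|) :=
  ⟨2 * n, by rintro _ ⟨q, rfl⟩; exact abs_centredStat_le hψ x p q⟩

lemma iSup_abs_centredStat_mem (hψ : IsRhoFunction ψ) (x : ∀ i, 𝒳 i)
    (B : Set (∀ i, 𝒳 i → ℝ≥0)) :
    (⨆ q : B, |centredStat ψ P x p q|) ∈ Set.Icc (0 : ℝ) (2 * n) :=
  ⟨Real.iSup_nonneg fun _ => abs_nonneg _,
    Real.iSup_le (fun q => abs_centredStat_le hψ x p q) (by positivity)⟩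

lemma fluctuation_le (hψ : IsRhoFunction ψ) : fluctuation ψ μ P 𝒬 p z ≤ 2 * n := by
  have h2 := norm_integral_le_of_norm_le_const (μ := Measure.pi P)
    (f := fun x => ⨆ q : lossBall μ P 𝒬 p z, |centredStat ψ P x p q|) (C := 2 * n)
    (ae_of_all _ fun x => by
      have := iSup_abs_centredStat_mem (P := P) (p := p) hψ x (lossBall μ P 𝒬 p z)
      rw [Real.norm_eq_abs, abs_of_nonneg this.1]
      exact this.2)
  rw [fluctuation_eq_integral_iSup]
  refine (le_abs_self _).trans ?_
  simpa using h2

lemma exists_lossSq_lt_mem_lossBall (h𝒬 : ∀ q ∈ 𝒬, IsProductDensity μ q)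
    {q : ∀ i, 𝒳 i → ℝ≥0} (hq : q ∈ lossBall μ P 𝒬 p z) :
    ∃ δ > 0, ∀ s ∈ 𝒬, lossSq (law μ s) (law μ q) < δ → s ∈ lossBall μ P 𝒬 p z := by
  set a := lossSq P (law μ q) with ha
  have ha0 : 0 ≤ a := lossSq_nonneg
  set γ := z - lossSq P (law μ p) - a with hγ
  have hγ0 : 0 < γ := by linarith [hq.2]
  have hε : 0 < γ / (2 * (a + 1)) := by positivity
  set ε := γ / (2 * (a + 1)) with hεd
  refine ⟨γ / 2 / (1 + ε⁻¹), by positivity, fun s hs hsq => ⟨hs, ?_⟩⟩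
  have : ∀ i, IsProbabilityMeasure (law μ s i) := fun i => (h𝒬 s hs i).2
  have : ∀ i, IsProbabilityMeasure (law μ q i) := fun i => (h𝒬 q hq.1 i).2
  have h1 := lossSq_le_add (P := P) (Q := law μ q) (R := law μ s) hε
  rw [lossSq_comm, lt_div_iff₀ (by positivity)] at hsq
  have h2 : ε * (2 * (a + 1)) = γ := div_mul_cancel₀ _ (by positivity)
  nlinarith

lemma exists_mem_lossBall_abs_sub_lt (h𝒬 : ∀ q ∈ 𝒬, IsProductDensity μ q) (hS : S ⊆ 𝒬)
    {x : ∀ i, 𝒳 i} (hx : ∀ q ∈ 𝒬, ∀ ε > 0, ∃ s ∈ S,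
      lossSq (law μ s) (law μ q) < ε ∧ |centredStat ψ P x p s - centredStat ψ P x p q| < ε)
    {q : ∀ i, 𝒳 i → ℝ≥0} (hq : q ∈ lossBall μ P 𝒬 p z) {ε : ℝ} (hε : 0 < ε) :
    ∃ s ∈ S ∩ lossBall μ P 𝒬 p z, |centredStat ψ P x p q| ≤ |centredStat ψ P x p s| + ε := by
  obtain ⟨δ, hδ, h⟩ := exists_lossSq_lt_mem_lossBall h𝒬 hq
  obtain ⟨s, hs, h1, h2⟩ := hx q hq.1 (min δ ε) (lt_min hδ hε)
  refine ⟨s, ⟨hs, h s (hS hs) (h1.trans_le (min_le_left _ _))⟩, ?_⟩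
  have h3 := abs_sub_abs_le_abs_sub (centredStat ψ P x p q) (centredStat ψ P x p s)
  rw [abs_sub_comm] at h3
  linarith [min_le_right δ ε]

/-- For a separable process the supremum in the definition of the fluctuation is almost surely equal
to a supremum over a countable set, so that its expectation is a genuine one. -/
lemma integrable_iSup_abs_centredStat (hψ : IsRhoFunction ψ)
    (h𝒬 : ∀ q ∈ 𝒬, IsProductDensity μ q) (hp : IsProductDensity μ p)
    (hsep : IsSeparableProcess ψ μ P 𝒬 p) :
    Integrable (fun x => ⨆ q : lossBall μ P 𝒬 p z, |centredStat ψ P x p q|) (Measure.pi P) := by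
  obtain ⟨S, hS, hSc, hae⟩ := hsep
  have : Countable ↥(S ∩ lossBall μ P 𝒬 p z) := (hSc.mono Set.inter_subset_left).to_subtype
  have hm : Measurable fun x => ⨆ q : ↥(S ∩ lossBall μ P 𝒬 p z), |centredStat ψ P x p q| :=
    Measurable.iSup fun q =>
      (measurable_centredStat (P := P) hψ hp (h𝒬 _ (hS q.2.1))).abs
  have hi : Integrable (fun x => ⨆ q : ↥(S ∩ lossBall μ P 𝒬 p z), |centredStat ψ P x p q|)
      (Measure.pi P) :=
    integrable_of_abs_le hm (C := 2 * n) fun x => by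
      have := iSup_abs_centredStat_mem (P := P) (p := p) hψ x (S ∩ lossBall μ P 𝒬 p z)
      rw [abs_of_nonneg this.1]
      exact this.2
  refine hi.congr ?_
  filter_upwards [hae] with x hx
  refine le_antisymm ?_ ?_
  · refine Real.iSup_le (fun q => ?_)
      (iSup_abs_centredStat_mem (P := P) (p := p) hψ x (lossBall μ P 𝒬 p z)).1
    exact le_ciSup (bddAbove_abs_centredStat (P := P) (p := p) hψ x (lossBall μ P 𝒬 p z))
      ⟨q.1, q.2.2⟩
  · refine Real.iSup_le (fun q => ?_)
      (iSup_abs_centredStat_mem (P := P) (p := p) hψ x (S ∩ lossBall μ P 𝒬 p z)).1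
    refine le_of_forall_pos_le_add fun ε hε => ?_
    obtain ⟨s, hs, h⟩ := exists_mem_lossBall_abs_sub_lt h𝒬 hS hx q.2 hε
    have := le_ciSup (bddAbove_abs_centredStat (P := P) (p := p) hψ x
      (S ∩ lossBall μ P 𝒬 p z)) ⟨s, hs⟩
    linarith

/-- Deviations of the process at a fixed scale. -/
lemma exists_abs_centredStat_le_of_scale (ha₂ : 1 ≤ a₂ ^ 2) (hψ : IsRhoFunction ψ)
    (hM : SatisfiesMoments a₀ a₁ a₂ ψ μ 𝒬') (h𝒬' : 𝒬 ⊆ 𝒬') (hpQ : p ∈ 𝒬')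
    (h𝒬 : ∀ q ∈ 𝒬, IsProductDensity μ q) (hp : IsProductDensity μ p)
    (hsep : IsSeparableProcess ψ μ P 𝒬 p) {t : ℝ} (ht0 : 0 < t) (ht : t ≤ 1 / 8)
    (ξ : ℝ) :
    ∃ E : Set (∀ i, 𝒳 i), MeasurableSet E ∧
      Measure.pi P Eᶜ ≤ ENNReal.ofReal (Real.exp (-ξ)) ∧
      ∀ x ∈ E, ∀ q ∈ lossBall μ P 𝒬 p z, |centredStat ψ P x p q| ≤
        2 * fluctuation ψ μ P 𝒬 p z + 32 * (a₂ ^ 2 + 1) * z * t + ξ / t := by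
  set b := 2 * fluctuation ψ μ P 𝒬 p z + 32 * (a₂ ^ 2 + 1) * z * t + ξ / t with hb
  have hgi := integrable_iSup_abs_centredStat (z := z) hψ h𝒬 hp hsep
  obtain ⟨S, hS, hSc, hae⟩ := hsep
  have hdev : Measure.pi P {x | ∃ s ∈ S ∩ lossBall μ P 𝒬 p z, b < |centredStat ψ P x p s|} ≤
      ENNReal.ofReal (Real.exp (-ξ)) := by
    rcases (S ∩ lossBall μ P 𝒬 p z).eq_empty_or_nonempty with he | hne
    · simp [he]
    obtain ⟨u, hu⟩ := (hSc.mono Set.inter_subset_left : (S ∩ lossBall μ P 𝒬 p z).Countable)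
      |>.exists_eq_range hne
    have huB : ∀ j, u j ∈ S ∩ lossBall μ P 𝒬 p z := fun j => hu ▸ Set.mem_range_self j
    have hud : ∀ j, IsProductDensity μ (u j) := fun j => h𝒬 _ (huB j).2.1
    have hZ : ∀ j x, centredStat ψ P x p (u j) = ∑ k, centredPsi ψ P p (u j) k (x k) :=
      fun j x => centredStat_eq_sum hψ (fun i => (hp i).1) (fun i => (hud j i).1) x
    have key := measure_exists_abs_sum_gt_le (P := P) (u := fun j => centredPsi ψ P p (u j))
      (fun j k => measurable_centredPsi hψ (hp k).1 (hud j k).1)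
      (fun j k => abs_centredPsi_le_two hψ p (u j) k)
      (fun j k => integral_centredPsi hψ (hp k).1 (hud j k).1)
      (V := 4 * (a₂ ^ 2 + 1) * z) (fun j =>
        (sum_integral_centredPsi_sq_le ha₂ hψ hM hpQ (h𝒬' (huB j).2.1) hp (hud j)).trans
          (mul_le_mul_of_nonneg_left (huB j).2.2.le (by positivity)))
      hgi (ae_of_all _ fun x j => by
        rw [← hZ]
        exact le_ciSup (bddAbove_abs_centredStat (P := P) (p := p) hψ x (lossBall μ P 𝒬 p z))
          ⟨u j, (huB j).2⟩) ht0 ht ξ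
    refine le_trans (measure_mono ?_) key
    rintro x ⟨s, hs, hsb⟩
    rw [hu] at hs
    obtain ⟨j, rfl⟩ := hs
    refine ⟨j, ?_⟩
    rw [← hZ, ← fluctuation_eq_integral_iSup]
    refine lt_of_eq_of_lt ?_ hsb
    rw [hb]; ring
  -- The set where separability fails need not be measurable: a measurable cover is removed.
  set bad := {x | ∃ s ∈ S ∩ lossBall μ P 𝒬 p z, b < |centredStat ψ P x p s|} ∪
    {x | ¬ ∀ q ∈ 𝒬, ∀ ε > 0, ∃ s ∈ S, lossSq (law μ s) (law μ q) < ε ∧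
      |centredStat ψ P x p s - centredStat ψ P x p q| < ε} with hbad
  refine ⟨(toMeasurable (Measure.pi P) bad)ᶜ, (measurableSet_toMeasurable _ _).compl, ?_, ?_⟩
  · rw [compl_compl, measure_toMeasurable]
    refine (measure_union_le _ _).trans ?_
    rw [ae_iff.1 hae, add_zero]
    exact hdev
  · intro x hx q hq
    have hx' : x ∉ bad := fun h => hx (subset_toMeasurable _ _ h)
    rw [hbad, Set.mem_union, not_or] at hx'
    have h1 : ∀ s ∈ S ∩ lossBall μ P 𝒬 p z, |centredStat ψ P x p s| ≤ b := by
      intro s hs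
      by_contra h
      exact hx'.1 ⟨s, hs, not_le.1 h⟩
    have h2 := not_not.1 hx'.2
    refine le_of_forall_pos_le_add fun ε hε => ?_
    obtain ⟨s, hs, h⟩ := exists_mem_lossBall_abs_sub_lt h𝒬 hS h2 hq hε
    exact h.trans (by linarith [h1 s hs])

end Fluctuation

/-! ### The constants -/

section Constants

variable {a₁ a₂ : ℝ}

/-- The argument of the Laplace transform: small enough for the variance term at scale `z` to be at
most `(a₁ / 16) z`. -/
noncomputable def laplaceArg (a₁ a₂ : ℝ) : ℝ := a₁ / (512 * (a₂ ^ 2 + 1))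

/-- The ratio of the smallest scale of the peeling to the dimension. -/
noncomputable def peelRatio (a₁ a₂ : ℝ) : ℝ := 16 / (a₁ * laplaceArg a₁ a₂) + (4 * a₂ / a₁) ^ 2

/-- The constant `κ` of the penalty. -/
noncomputable def penConst (a₁ a₂ : ℝ) : ℝ := 3 / 8 * a₁ * peelRatio a₁ a₂ + 1 / laplaceArg a₁ a₂

/-- The constant of the deviation bound. -/
noncomputable def riskConst (a₁ a₂ : ℝ) : ℝ :=
  16 / a₁ * (meanConst a₁ a₂ + a₁ + 1 + penConst a₁ a₂)

lemma laplaceArg_pos (ha₁ : 0 < a₁) : 0 < laplaceArg a₁ a₂ := by unfold laplaceArg; positivity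

lemma laplaceArg_le (ha₁ : a₁ ≤ 1) : laplaceArg a₁ a₂ ≤ 1 / 8 := by
  unfold laplaceArg
  rw [div_le_iff₀ (by positivity)]
  nlinarith [sq_nonneg a₂]

lemma peelRatio_pos (ha₁ : 0 < a₁) : 0 < peelRatio a₁ a₂ := by
  have := laplaceArg_pos (a₂ := a₂) ha₁
  unfold peelRatio; positivity

lemma penConst_pos (ha₁ : 0 < a₁) : 0 < penConst a₁ a₂ := by
  have := laplaceArg_pos (a₂ := a₂) ha₁
  have := peelRatio_pos (a₂ := a₂) ha₁
  unfold penConst; positivity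

lemma meanConst_nonneg (ha₁ : 0 < a₁) : 0 ≤ meanConst a₁ a₂ := by
  unfold meanConst; positivity

lemma one_le_riskConst (ha₁ : 0 < a₁) : 1 ≤ riskConst a₁ a₂ := by
  have h1 := penConst_pos (a₂ := a₂) ha₁
  have h2 := meanConst_nonneg (a₂ := a₂) ha₁
  unfold riskConst
  rw [div_mul_eq_mul_div, le_div_iff₀ ha₁]
  linarith

end Constants

/-! ### Peeling -/

section Peeling

variable {n : ℕ} {𝒳 : Fin n → Type*} [∀ i, MeasurableSpace (𝒳 i)] {μ P : ∀ i, Measure (𝒳 i)}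
  {ψ : ℝ≥0∞ → ℝ} {a₀ a₁ a₂ : ℝ} {𝒬 𝒬' : Set (∀ i, 𝒳 i → ℝ≥0)}
  {p : ∀ i, 𝒳 i → ℝ≥0}

lemma one_le_dimension : 1 ≤ dimension a₁ a₂ ψ μ P 𝒬 p := le_max_left _ _

variable [∀ i, IsProbabilityMeasure (P i)]

/-- Beyond a scale proportional to the dimension, the expected fluctuations are small. -/
lemma fluctuation_le_of_dimension_lt (ha₁ : 0 < a₁) (ha₂ : 1 ≤ a₂ ^ 2) (hψ : IsRhoFunction ψ)
    {z : ℝ} (hz : (4 * a₂ / a₁) ^ 2 * dimension a₁ a₂ ψ μ P 𝒬 p < z) :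
    fluctuation ψ μ P 𝒬 p z ≤ a₁ / 8 * z := by
  have hD := one_le_dimension (a₁ := a₁) (a₂ := a₂) (ψ := ψ) (μ := μ) (P := P) (𝒬 := 𝒬) (p := p)
  have hz0 : 0 < z := lt_of_le_of_lt (by positivity) hz
  by_contra h
  -- The fluctuations are at most `2 n`, so that the supremum in the dimension is a genuine one.
  have hbdd : BddAbove {z : ℝ | 0 < z ∧ a₁ / 8 * z < fluctuation ψ μ P 𝒬 p z} := by
    refine ⟨2 * n / (a₁ / 8), fun y hy => ?_⟩
    rw [le_div_iff₀ (by positivity)]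
    have := fluctuation_le (μ := μ) (P := P) (𝒬 := 𝒬) (p := p) (z := y) hψ
    linarith [hy.2]
  have h1 := le_csSup hbdd ⟨hz0, not_le.1 h⟩
  have h2 : (a₁ / (4 * a₂)) ^ 2 *
      sSup {z : ℝ | 0 < z ∧ a₁ / 8 * z < fluctuation ψ μ P 𝒬 p z} ≤
        dimension a₁ a₂ ψ μ P 𝒬 p := le_max_right _ _
  have ha₂' : a₂ ≠ 0 := by rintro rfl; norm_num at ha₂
  have h3 : (4 * a₂ / a₁) ^ 2 * (a₁ / (4 * a₂)) ^ 2 = 1 := by field_simp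
  have h4 := mul_le_mul_of_nonneg_left h2 (sq_nonneg (4 * a₂ / a₁))
  rw [← mul_assoc, h3, one_mul] at h4
  linarith

/-- The sum over the scales of the probabilities of the exceptional sets. -/
lemma tsum_ofReal_exp_neg_add_log_two (ξ : ℝ) :
    ∑' j : ℕ, ENNReal.ofReal (Real.exp (-(ξ + (j + 1) * Real.log 2))) =
      ENNReal.ofReal (Real.exp (-ξ)) := by
  have h : ∀ j : ℕ, Real.exp (-(ξ + (j + 1) * Real.log 2)) =
      Real.exp (-ξ) * ((1 / 2) * (1 / 2) ^ j) := by
    intro j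
    rw [neg_add, Real.exp_add, ← pow_succ', one_div, inv_pow, Real.exp_neg ((j + 1) * Real.log 2)]
    congr 2
    rw [← Real.rpow_natCast, Real.rpow_def_of_pos two_pos]
    push_cast
    ring_nf
  simp only [h]
  rw [← ENNReal.ofReal_tsum_of_nonneg (fun j => by positivity)
    ((summable_geometric_two.mul_left _).mul_left _), tsum_mul_left, tsum_mul_left,
    tsum_geometric_two]
  norm_num

/-- A uniform bound for the process, obtained by slicing the model into dyadic shells. -/
lemma exists_abs_centredStat_le (ha₁ : 0 < a₁) (ha₁' : a₁ ≤ 1) (ha₂ : 1 ≤ a₂ ^ 2)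
    (hψ : IsRhoFunction ψ) (hM : SatisfiesMoments a₀ a₁ a₂ ψ μ 𝒬') (h𝒬' : 𝒬 ⊆ 𝒬') (hpQ : p ∈ 𝒬')
    (h𝒬 : ∀ q ∈ 𝒬, IsProductDensity μ q) (hp : IsProductDensity μ p)
    (hsep : IsSeparableProcess ψ μ P 𝒬 p) {ξ : ℝ} (hξ : 0 ≤ ξ) :
    ∃ E : Set (∀ i, 𝒳 i), MeasurableSet E ∧
      Measure.pi P Eᶜ ≤ ENNReal.ofReal (Real.exp (-ξ)) ∧
      ∀ x ∈ E, ∀ q ∈ 𝒬, |centredStat ψ P x p q| ≤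
        3 / 4 * a₁ * (lossSq P (law μ p) + lossSq P (law μ q)) +
          penConst a₁ a₂ * (dimension a₁ a₂ ψ μ P 𝒬 p + ξ) := by
  set t := laplaceArg a₁ a₂ with ht
  have ht0 : 0 < t := laplaceArg_pos ha₁
  have ht8 : t ≤ 1 / 8 := laplaceArg_le ha₁'
  set D := dimension a₁ a₂ ψ μ P 𝒬 p
  have hD1 : 1 ≤ D := one_le_dimension
  set K := peelRatio a₁ a₂ with hK
  have hK0 : 0 < K := peelRatio_pos ha₁
  set z : ℕ → ℝ := fun j => 2 ^ j * (K * D) with hz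
  have hz0 : 0 < K * D := by positivity
  have h2j : ∀ j : ℕ, (1 : ℝ) ≤ 2 ^ j := fun j => one_le_pow₀ one_le_two
  have hzK : ∀ j, K * D ≤ z j := fun j => le_mul_of_one_le_left hz0.le (h2j j)
  have hfl : ∀ j, fluctuation ψ μ P 𝒬 p (z j) ≤ a₁ / 8 * z j := fun j => by
    refine fluctuation_le_of_dimension_lt ha₁ ha₂ hψ (lt_of_lt_of_le ?_ (hzK j))
    refine mul_lt_mul_of_pos_right ?_ (by linarith)
    have : 0 < 16 / (a₁ * t) := by positivity
    rw [hK, peelRatio]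
    linarith
  choose E hEm hEP hE using fun j : ℕ => exists_abs_centredStat_le_of_scale (z := z j) ha₂ hψ hM
    h𝒬' hpQ h𝒬 hp hsep ht0 ht8 (ξ + (j + 1) * Real.log 2)
  refine ⟨⋂ j, E j, MeasurableSet.iInter hEm, ?_, fun x hx q hq => ?_⟩
  · rw [Set.compl_iInter]
    refine (measure_iUnion_le _).trans ((ENNReal.tsum_le_tsum hEP).trans ?_)
    rw [tsum_ofReal_exp_neg_add_log_two]
  have hvar : ∀ j, 32 * (a₂ ^ 2 + 1) * z j * t = a₁ / 16 * z j := fun j => by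
    rw [ht, laplaceArg]; field_simp; ring
  have hlog : ∀ j : ℕ, (j + 1) * Real.log 2 / t ≤ a₁ / 16 * z j := fun j => by
    have h1 : ((j : ℝ) + 1) ≤ 2 ^ j := by exact_mod_cast Nat.lt_two_pow_self (n := j)
    have h2 : (j + 1) * Real.log 2 ≤ 2 ^ j := by
      have := Real.log_two_lt_d9
      have h3 : Real.log 2 ≤ 1 := by linarith
      have h4 : (0 : ℝ) ≤ j + 1 := by positivity
      nlinarith
    have h5 : 16 / (a₁ * t) ≤ K * D := by
      have : 16 / (a₁ * t) ≤ K := by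
        rw [hK, peelRatio]; linarith [sq_nonneg (4 * a₂ / a₁)]
      nlinarith
    rw [div_le_iff₀ (by positivity)] at h5
    rw [div_le_iff₀ ht0]
    have h6 := mul_le_mul_of_nonneg_left h5 (zero_le_one.trans (h2j j))
    simp only [hz]
    linarith
  have hbound : ∀ j, q ∈ lossBall μ P 𝒬 p (z j) →
      |centredStat ψ P x p q| ≤ 3 / 8 * a₁ * z j + ξ / t := fun j hj => by
    have h1 := hE j x (Set.mem_iInter.1 hx j) q hj
    rw [hvar, add_div] at h1
    linarith [hfl j, hlog j]
  set r := lossSq P (law μ p) + lossSq P (law μ q)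
  have hr0 : 0 ≤ r := add_nonneg lossSq_nonneg lossSq_nonneg
  have hpen : penConst a₁ a₂ * (D + ξ) =
      3 / 8 * a₁ * (K * D) + ξ / t + 3 / 8 * a₁ * (K * ξ) + D / t := by
    rw [penConst]; ring
  have hpos1 : 0 ≤ a₁ * (K * ξ) := by positivity
  have hpos2 : 0 ≤ D / t := by positivity
  have hpos3 : 0 ≤ a₁ * (K * D) := by positivity
  have hpos4 : 0 ≤ a₁ * r := by positivity
  rw [hpen]
  rcases lt_or_ge r (K * D) with hlt | hge
  · have := hbound 0 ⟨hq, by simpa [hz] using hlt⟩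
    simp only [hz, pow_zero, one_mul] at this
    linarith
  · obtain ⟨j, hj1, hj2⟩ := exists_nat_pow_near (x := r / (K * D)) (y := 2)
      ((one_le_div hz0).2 hge) one_lt_two
    rw [le_div_iff₀ hz0] at hj1
    rw [div_lt_iff₀ hz0] at hj2
    have h1 := hbound (j + 1) ⟨hq, hj2⟩
    have h2 : z (j + 1) = 2 * (2 ^ j * (K * D)) := by simp only [hz]; ring
    rw [h2] at h1
    have h3 := mul_le_mul_of_nonneg_left hj1 ha₁.le
    linarith

end Peeling

/-! ### The risk of the estimator -/

section Risk

variable {n : ℕ} {𝒳 : Fin n → Type*} [∀ i, MeasurableSpace (𝒳 i)] {μ P : ∀ i, Measure (𝒳 i)}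
  [∀ i, IsProbabilityMeasure (P i)] {ψ : ℝ≥0∞ → ℝ} {a₀ a₁ a₂ : ℝ}
  {pen : (∀ i, Measure (𝒳 i)) → ℝ} {phat : (∀ i, 𝒳 i) → ∀ i, 𝒳 i → ℝ≥0}

/-- The comparison of the criterion at the estimator and at `p`: a lower bound for the first, from
the choice `q' = p` in the supremum, and an upper bound for the second. -/
lemma stat_le_of_isRhoEstimator {𝒬 : Set (∀ i, 𝒳 i → ℝ≥0)} (hψ : IsRhoFunction ψ)
    (hpen : ∀ q ∈ 𝒬, 0 ≤ pen (law μ q)) (hphat : IsRhoEstimator ψ μ pen 𝒬 phat)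
    {p : ∀ i, 𝒳 i → ℝ≥0} (hp : p ∈ 𝒬) (x : ∀ i, 𝒳 i) {B : ℝ}
    (hB : ∀ q ∈ 𝒬, stat ψ x p q - pen (law μ q) ≤ B) :
    pen (law μ (phat x)) - stat ψ x p (phat x) ≤ B + 2 * pen (law μ p) := by
  have hbdd : BddAbove (Set.range fun q' : 𝒬 =>
      stat ψ x (phat x) q' - pen (law μ (q' : ∀ i, 𝒳 i → ℝ≥0))) := by
    refine ⟨n, ?_⟩
    rintro _ ⟨q, rfl⟩
    have h1 := (abs_le.1 (abs_stat_le hψ x (phat x) q)).2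
    have h2 := hpen q q.2
    dsimp only
    linarith
  have h1 := le_ciSup hbdd ⟨p, hp⟩
  dsimp only at h1
  have h2 := (hphat x).2 p hp
  have : Nonempty 𝒬 := ⟨⟨p, hp⟩⟩
  have h3 : (⨆ q' : 𝒬, (stat ψ x p q' - pen (law μ (q' : ∀ i, 𝒳 i → ℝ≥0)))) ≤ B :=
    ciSup_le fun q => hB q q.2
  unfold criterion at h2
  rw [stat_swap hψ] at h1
  linarith

variable {M : Type*} {𝒬 : M → Set (∀ i, 𝒳 i → ℝ≥0)} {Δ : M → ℝ}

/-- The risk bound of the estimator, with the constants made explicit. -/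
lemma exists_lossSq_le (ha₁ : 0 < a₁) (ha₁' : a₁ ≤ 1) (ha₂ : 1 ≤ a₂ ^ 2) [Countable M]
    (h𝒬 : ∀ m, ∀ q ∈ 𝒬 m, IsProductDensity μ q) (hΔ : HasSum (fun m => Real.exp (-Δ m)) 1)
    (hψ : IsRhoFunction ψ) (hM : SatisfiesMoments a₀ a₁ a₂ ψ μ (⋃ m, 𝒬 m))
    (hsep : ∀ m, ∀ p ∈ ⋃ m, 𝒬 m, IsSeparableProcess ψ μ P (𝒬 m) p)
    (hpen : ∀ q ∈ ⋃ m, 𝒬 m, 0 ≤ pen (law μ q))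
    (hphat : IsRhoEstimator ψ μ pen (⋃ m, 𝒬 m) phat) {G : (∀ i, Measure (𝒳 i)) → ℝ}
    (hG : ∀ p ∈ ⋃ m, 𝒬 m, ∀ m, ∀ q ∈ 𝒬 m,
      penConst a₁ a₂ * (dimension a₁ a₂ ψ μ P (𝒬 m) p + Δ m) ≤ G (law μ p) + pen (law μ q))
    {p : ∀ i, 𝒳 i → ℝ≥0} (hp : p ∈ ⋃ m, 𝒬 m) {ξ : ℝ} (hξ : 0 ≤ ξ) :
    ∃ A : Set (∀ i, 𝒳 i), MeasurableSet A ∧ (Measure.pi P).real Aᶜ ≤ Real.exp (-ξ) ∧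
      0 ≤ G (law μ p) + pen (law μ p) ∧
      ∀ x ∈ A, lossSq P (law μ (phat x)) ≤
        riskConst a₁ a₂ * (lossSq P (law μ p) + G (law μ p) + pen (law μ p) + ξ) := by
  have hd : ∀ q ∈ ⋃ m, 𝒬 m, IsProductDensity μ q := fun q hq => by
    obtain ⟨m, hm⟩ := Set.mem_iUnion.1 hq
    exact h𝒬 m q hm
  have hΔ0 : ∀ m, 0 ≤ Δ m := fun m => by
    have h1 := le_hasSum hΔ m fun _ _ => (Real.exp_pos _).le
    rw [Real.exp_le_one_iff] at h1
    linarith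
  set κ := penConst a₁ a₂
  have hκ0 : 0 < κ := penConst_pos ha₁
  choose E hEm hEP hE using fun m => exists_abs_centredStat_le ha₁ ha₁' ha₂ hψ hM
    (Set.subset_iUnion 𝒬 m) hp (h𝒬 m) (hd p hp) (hsep m p hp) (add_nonneg hξ (hΔ0 m))
  have hGp : 0 ≤ G (law μ p) + pen (law μ p) := by
    obtain ⟨m, hm⟩ := Set.mem_iUnion.1 hp
    refine le_trans ?_ (hG p hp m p hm)
    have := one_le_dimension (a₁ := a₁) (a₂ := a₂) (ψ := ψ) (μ := μ) (P := P) (𝒬 := 𝒬 m) (p := p)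
    have := hΔ0 m
    positivity
  refine ⟨⋂ m, E m, MeasurableSet.iInter hEm, ?_, hGp, fun x hx => ?_⟩
  · rw [measureReal_def]
    refine ENNReal.toReal_le_of_le_ofReal (Real.exp_pos _).le ?_
    rw [Set.compl_iInter]
    refine (measure_iUnion_le _).trans ((ENNReal.tsum_le_tsum hEP).trans (le_of_eq ?_))
    have h1 : ∀ m, Real.exp (-(ξ + Δ m)) = Real.exp (-ξ) * Real.exp (-Δ m) := fun m => by
      rw [← Real.exp_add]; ring_nf
    simp only [h1]
    rw [← ENNReal.ofReal_tsum_of_nonneg (fun m => by positivity) (hΔ.summable.mul_left _),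
      tsum_mul_left, hΔ.tsum_eq, mul_one]
  set H := lossSq P (law μ p)
  have hH0 : 0 ≤ H := lossSq_nonneg
  have hmean : ∀ q ∈ ⋃ m, 𝒬 m, ∫ y, stat ψ y p q ∂(Measure.pi P) ≤
      meanConst a₁ a₂ * H - 7 / 8 * a₁ * lossSq P (law μ q) := fun q hq =>
    integral_stat_le ha₁ ha₂ hψ hM hp hq (hd p hp) (hd q hq)
  -- The uniform upper bound for the statistic, with the dimension absorbed by the penalty.
  have hstat : ∀ q ∈ ⋃ m, 𝒬 m, stat ψ x p q - pen (law μ q) ≤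
      (meanConst a₁ a₂ + a₁) * H - a₁ / 8 * lossSq P (law μ q) + G (law μ p) + κ * ξ := by
    intro q hq
    obtain ⟨m, hm⟩ := Set.mem_iUnion.1 hq
    have h1 := (abs_le.1 (hE m x (Set.mem_iInter.1 hx m) q hm)).2
    have h2 := hG p hp m q hm
    have h3 := hmean q hq
    have h4 : 0 ≤ a₁ * H := by positivity
    unfold centredStat at h1
    linarith
  have hcrit := stat_le_of_isRhoEstimator hψ hpen hphat hp x
    (B := (meanConst a₁ a₂ + a₁) * H + G (law μ p) + κ * ξ) fun q hq => by
      have h1 := hstat q hq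
      have h2 : 0 ≤ a₁ / 8 * lossSq P (law μ q) := mul_nonneg (by positivity) lossSq_nonneg
      linarith
  have hhat : a₁ / 8 * lossSq P (law μ (phat x)) ≤
      2 * ((meanConst a₁ a₂ + a₁) * H) + 2 * (G (law μ p) + pen (law μ p)) + 2 * (κ * ξ) := by
    have hq := (hphat x).1
    obtain ⟨m, hm⟩ := Set.mem_iUnion.1 hq
    have h1 := (abs_le.1 (hE m x (Set.mem_iInter.1 hx m) _ hm)).2
    have h2 := hG p hp m _ hm
    have h3 := hmean _ hq
    have h4 : 0 ≤ a₁ * H := by positivity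
    unfold centredStat at h1
    linarith
  have hm0 := meanConst_nonneg (a₂ := a₂) ha₁
  have h5 : lossSq P (law μ (phat x)) ≤ 16 / a₁ * ((meanConst a₁ a₂ + a₁) * H +
      (G (law μ p) + pen (law μ p)) + κ * ξ) := by
    rw [div_mul_eq_mul_div, le_div_iff₀ ha₁]
    linarith
  refine h5.trans ?_
  rw [riskConst, mul_assoc]
  refine mul_le_mul_of_nonneg_left ?_ (by positivity)
  have e1 : 0 ≤ (1 + κ) * H := by positivity
  have e2 : 0 ≤ (meanConst a₁ a₂ + a₁ + κ) * (G (law μ p) + pen (law μ p)) := by positivity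
  have e3 : 0 ≤ (meanConst a₁ a₂ + a₁ + 1) * ξ := by positivity
  linarith

end Risk

/-! ### From deviation bounds to expectations -/

section Expectation

/-- Integration of exponential deviation bounds for a function that is bounded by `n`: only the
first `n` integer levels are needed, and their exceptional sets have probabilities that sum to at most
one. -/
lemma exists_integrable_bound {Ω : Type*} [MeasurableSpace Ω] {ν : Measure Ω}
    [IsProbabilityMeasure ν] {h : Ω → ℝ} {n : ℕ} (hn : ∀ x, h x ≤ n) {b c : ℝ} (hb : 0 ≤ b)
    (hc : 1 ≤ c) {A : ℕ → Set Ω} (hAm : ∀ k, MeasurableSet (A k))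
    (hA : ∀ k : ℕ, ν.real (A k)ᶜ ≤ Real.exp (-(k + 1)))
    (hh : ∀ k : ℕ, ∀ x ∈ A k, h x ≤ c * (b + (k + 1))) :
    ∃ g : Ω → ℝ, Measurable g ∧ Integrable g ν ∧ (∀ x, h x ≤ g x) ∧
      ∫ x, g x ∂ν ≤ c * (b + 2) := by
  set s : Ω → ℝ := fun x => ∑ k ∈ Finset.range n, (A k)ᶜ.indicator (fun _ => (1 : ℝ)) x with hs
  have hi : ∀ k, Integrable ((A k)ᶜ.indicator fun _ => (1 : ℝ)) ν := fun k =>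
    (integrable_const 1).indicator (hAm k).compl
  have hsi : Integrable s ν := integrable_finsetSum _ fun k _ => hi k
  have hsm : Measurable s := Finset.measurable_sum _ fun k _ =>
    measurable_const.indicator (hAm k).compl
  refine ⟨fun x => c * (b + 1 + s x), (hsm.const_add _).const_mul c,
    ((integrable_const _).add hsi).const_mul c, fun x => ?_, ?_⟩
  · have h0 : ∀ k, 0 ≤ (A k)ᶜ.indicator (fun _ => (1 : ℝ)) x := fun k =>
      Set.indicator_nonneg (fun _ _ => zero_le_one) x
    -- If `k` is the first level whose event contains `x`, the `k` previous indicators are one.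
    have hcount : ∀ k ≤ n, (∀ j < k, x ∉ A j) → (k : ℝ) ≤ s x := by
      intro k hk hj
      calc (k : ℝ) = ∑ j ∈ Finset.range k, (A j)ᶜ.indicator (fun _ => (1 : ℝ)) x := by
            rw [Finset.sum_congr rfl fun j hjk =>
              Set.indicator_of_mem (hj j (Finset.mem_range.1 hjk)) _]
            simp
        _ ≤ s x := Finset.sum_le_sum_of_subset_of_nonneg (Finset.range_mono hk) fun j _ _ => h0 j
    by_cases hx : ∃ k, k < n ∧ x ∈ A k
    · classical
      obtain ⟨hkn, hkA⟩ := Nat.find_spec hx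
      have h1 := hcount (Nat.find hx) hkn.le fun j hj hjA =>
        Nat.find_min hx hj ⟨hj.trans hkn, hjA⟩
      refine (hh _ x hkA).trans (mul_le_mul_of_nonneg_left ?_ (by linarith))
      linarith
    · have h1 := hcount n le_rfl fun j hj hjA => hx ⟨j, hj, hjA⟩
      have h2 := hn x
      dsimp only
      nlinarith
  · rw [integral_const_mul, integral_add (integrable_const _) hsi]
    refine mul_le_mul_of_nonneg_left ?_ (by linarith)
    have h1 : ∫ x, s x ∂ν ≤ 1 := by
      rw [hs, integral_finsetSum _ fun k _ => hi k]
      have h2 : ∀ k ∈ Finset.range n, ∫ x, (A k)ᶜ.indicator (fun _ => (1 : ℝ)) x ∂ν ≤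
          1 / 2 * (1 / 2) ^ k := by
        intro k _
        rw [integral_indicator_const _ (hAm k).compl, smul_eq_mul, mul_one]
        refine (hA k).trans ?_
        have h3 : Real.exp (-1) ≤ 1 / 2 := by
          rw [Real.exp_neg, one_div]
          exact inv_anti₀ two_pos (by linarith [Real.add_one_le_exp (1 : ℝ)])
        have h4 : Real.exp (-((k : ℝ) + 1)) = Real.exp (-1) ^ (k + 1) := by
          rw [← Real.exp_nat_mul]; push_cast; ring_nf
        rw [h4, ← pow_succ']
        exact pow_le_pow_left₀ (Real.exp_pos _).le h3 _
      refine (Finset.sum_le_sum h2).trans ?_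
      rw [← Finset.mul_sum]
      linarith [sum_geometric_two_le n]
    simp only [integral_const, probReal_univ, one_smul]
    linarith

end Expectation

end RhoEst

/-! ### The risk bound and the oracle inequality -/

open RhoEst
theorem mainTheorem2 (a₀ a₁ a₂ : ℝ) (ha₀ : 1 ≤ a₀) (ha₁ : a₁ ≤ 1) (ha₁' : 0 < a₁)
    (ha₂ : max 1 (6 * a₁) ≤ a₂ ^ 2) :
    ∃ κ C : ℝ, 0 < κ ∧ 1 ≤ C ∧
      ∀ (n : ℕ) (𝒳 : Fin n → Type*) [∀ i, MeasurableSpace (𝒳 i)]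
        (μ : ∀ i, Measure (𝒳 i)) [∀ i, SigmaFinite (μ i)]
        (M : Type*) [Countable M]
        (𝒬 : M → Set (∀ i, 𝒳 i → ℝ≥0))
        (_ : ∀ m, ∀ q ∈ 𝒬 m, IsProductDensity μ q)
        (Δ : M → ℝ) (_ : HasSum (fun m => Real.exp (-Δ m)) 1)
        (ψ : ℝ≥0∞ → ℝ) (_ : IsRhoFunction ψ)
        (_ : SatisfiesMoments a₀ a₁ a₂ ψ μ (⋃ m, 𝒬 m))
        (P : ∀ i, Measure (𝒳 i)) [∀ i, IsProbabilityMeasure (P i)]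
        (_ : ∀ m, ∀ p ∈ ⋃ m, 𝒬 m, IsSeparableProcess ψ μ P (𝒬 m) p)
        (pen : (∀ i, Measure (𝒳 i)) → ℝ) (_ : ∀ q ∈ ⋃ m, 𝒬 m, 0 ≤ pen (law μ q))
        (phat : (∀ i, 𝒳 i) → ∀ i, 𝒳 i → ℝ≥0)
        (_ : IsRhoEstimator ψ μ pen (⋃ m, 𝒬 m) phat),
        -- the deviation bound
        (∀ G : (∀ i, Measure (𝒳 i)) → ℝ,
          (∀ p ∈ ⋃ m, 𝒬 m, ∀ m, ∀ q ∈ 𝒬 m,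
            κ * (dimension a₁ a₂ ψ μ P (𝒬 m) p + Δ m) ≤ G (law μ p) + pen (law μ q)) →
          ∀ p ∈ ⋃ m, 𝒬 m, ∀ ξ : ℝ, 0 ≤ ξ →
            ∃ A : Set (∀ i, 𝒳 i), MeasurableSet A ∧
              1 - Real.exp (-ξ) ≤ (Measure.pi P).real A ∧
              ∀ x ∈ A, lossSq P (law μ (phat x)) ≤
                C * (lossSq P (law μ p) + G (law μ p) + pen (law μ p) + ξ)) ∧
        -- the oracle inequality over all models, in probability and in expectation
        (∀ dim : M → ℝ,
          (∀ m, ∀ p ∈ ⋃ m, 𝒬 m, dimension a₁ a₂ ψ μ P (𝒬 m) p ≤ dim m) →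
          (∀ m, ∀ q ∈ 𝒬 m, pen (law μ q) = κ * (dim m + Δ m)) →
          (∀ ξ : ℝ, 0 ≤ ξ →
            ∃ A : Set (∀ i, 𝒳 i), MeasurableSet A ∧
              1 - Real.exp (-ξ) ≤ (Measure.pi P).real A ∧
              ∀ x ∈ A, ∀ m, ∀ q ∈ 𝒬 m, lossSq P (law μ (phat x)) ≤
                C * (lossSq P (law μ q) + dim m + Δ m + ξ)) ∧
          ∃ g : (∀ i, 𝒳 i) → ℝ, Measurable g ∧ Integrable g (Measure.pi P) ∧
            (∀ x, lossSq P (law μ (phat x)) ≤ g x) ∧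
            ∀ m, ∀ q ∈ 𝒬 m, ∫ x, g x ∂(Measure.pi P) ≤
              C * (lossSq P (law μ q) + dim m + Δ m)) := by
  have ha₂' : 1 ≤ a₂ ^ 2 := (le_max_left _ _).trans ha₂
  have hκ : 0 < penConst a₁ a₂ := penConst_pos ha₁'
  have hr : 1 ≤ riskConst a₁ a₂ := one_le_riskConst ha₁'
  refine ⟨penConst a₁ a₂, 6 * (riskConst a₁ a₂ * (1 + penConst a₁ a₂)), hκ, by nlinarith, ?_⟩
  intro n 𝒳 _ μ _ M _ 𝒬 h𝒬 Δ hΔ ψ hψ hM P _ hsep pen hpen phat hphat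
  set κ := penConst a₁ a₂
  set c := riskConst a₁ a₂ * (1 + κ) with hc
  have hc1 : riskConst a₁ a₂ ≤ c := by rw [hc]; nlinarith
  have hΔ0 : ∀ m, 0 ≤ Δ m := fun m => by
    have h1 := le_hasSum hΔ m fun _ _ => (Real.exp_pos _).le
    rw [Real.exp_le_one_iff] at h1
    linarith
  have hcompl : ∀ {A : Set (∀ i, 𝒳 i)}, MeasurableSet A → ∀ {ξ : ℝ},
      (Measure.pi P).real Aᶜ ≤ Real.exp (-ξ) → 1 - Real.exp (-ξ) ≤ (Measure.pi P).real A := by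
    intro A hA ξ h
    rw [probReal_compl_eq_one_sub hA] at h
    linarith
  refine ⟨fun G hG p hp ξ hξ => ?_, fun dim hdim hpen' => ?_⟩
  · obtain ⟨A, hAm, hAP, hGp, hA⟩ := exists_lossSq_le ha₁' ha₁ ha₂' h𝒬 hΔ hψ hM hsep hpen hphat
      hG hp hξ
    refine ⟨A, hAm, hcompl hAm hAP, fun x hx => (hA x hx).trans ?_⟩
    refine mul_le_mul_of_nonneg_right (by linarith) ?_
    have := lossSq_nonneg (P := P) (Q := law μ p)
    linarith
  · have hne : Nonempty (∀ i, 𝒳 i) := (Measure.pi P).nonempty_of_neZero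
    set V : Set ℝ := {b | ∃ m, ∃ q ∈ 𝒬 m, b = lossSq P (law μ q) + dim m + Δ m}
    have hV1 : ∀ b ∈ V, 1 ≤ b := by
      rintro b ⟨m, q, hq, rfl⟩
      have h1 := hdim m q (Set.mem_iUnion.2 ⟨m, hq⟩)
      have h2 := one_le_dimension (a₁ := a₁) (a₂ := a₂) (ψ := ψ) (μ := μ) (P := P) (𝒬 := 𝒬 m)
        (p := q)
      have h3 := lossSq_nonneg (P := P) (Q := law μ q)
      linarith [hΔ0 m]
    have hVne : V.Nonempty := by
      obtain ⟨m, hm⟩ := Set.mem_iUnion.1 (hphat hne.some).1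
      exact ⟨_, m, _, hm, rfl⟩
    -- A pair `(m, q)` that is optimal up to a factor two, since the infimum may not be attained.
    obtain ⟨b, hbV, hb2⟩ : ∃ b ∈ V, ∀ b' ∈ V, b ≤ 2 * b' := by
      have h1 : 1 ≤ sInf V := le_csInf hVne hV1
      obtain ⟨b, hb, hlt⟩ := exists_lt_of_csInf_lt hVne (by linarith : sInf V < 2 * sInf V)
      exact ⟨b, hb, fun b' hb' => by linarith [csInf_le ⟨1, hV1⟩ hb']⟩
    have hb1 := hV1 b hbV
    obtain ⟨m₀, q₀, hq₀, hb⟩ := hbV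
    have hdev : ∀ ξ : ℝ, 0 ≤ ξ → ∃ A : Set (∀ i, 𝒳 i), MeasurableSet A ∧
        (Measure.pi P).real Aᶜ ≤ Real.exp (-ξ) ∧
        ∀ x ∈ A, lossSq P (law μ (phat x)) ≤ c * (b + ξ) := by
      intro ξ hξ
      obtain ⟨A, hAm, hAP, -, hA⟩ := exists_lossSq_le (G := fun _ => 0) ha₁' ha₁ ha₂' h𝒬 hΔ hψ hM
        hsep hpen hphat (fun p hp m q hq => by
          rw [hpen' m q hq, zero_add]
          exact mul_le_mul_of_nonneg_left (by linarith [hdim m p hp]) hκ.le)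
        (Set.mem_iUnion.2 ⟨m₀, hq₀⟩) hξ
      refine ⟨A, hAm, hAP, fun x hx => (hA x hx).trans ?_⟩
      rw [hpen' m₀ q₀ hq₀, hc, mul_assoc]
      refine mul_le_mul_of_nonneg_left ?_ (by linarith)
      have h1 : 0 ≤ κ * lossSq P (law μ q₀) := mul_nonneg hκ.le lossSq_nonneg
      have h2 : 0 ≤ κ * ξ := mul_nonneg hκ.le hξ
      have h3 : 1 ≤ dim m₀ := le_trans one_le_dimension
        (hdim m₀ q₀ (Set.mem_iUnion.2 ⟨m₀, hq₀⟩))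
      have h4 := hΔ0 m₀
      rw [hb]
      linarith
    have hc0 : 1 ≤ c := hr.trans hc1
    refine ⟨fun ξ hξ => ?_, ?_⟩
    · obtain ⟨A, hAm, hAP, hA⟩ := hdev ξ hξ
      refine ⟨A, hAm, hcompl hAm hAP, fun x hx m q hq => (hA x hx).trans ?_⟩
      have h1 := hb2 _ ⟨m, q, hq, rfl⟩
      have h2 := hV1 _ ⟨m, q, hq, rfl⟩
      nlinarith
    · choose A hAm hAP hA using fun k : ℕ => hdev (k + 1) (by positivity)
      have hlaw : ∀ x i, IsProbabilityMeasure (law μ (phat x) i) := fun x i => by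
        obtain ⟨m, hm⟩ := Set.mem_iUnion.1 (hphat x).1
        exact (h𝒬 m _ hm i).2
      obtain ⟨g, hgm, hgi, hg, hgint⟩ := exists_integrable_bound (ν := Measure.pi P)
        (h := fun x => lossSq P (law μ (phat x))) (n := n)
        (fun x => by have := hlaw x; exact lossSq_le_natCast) (by linarith) hc0 hAm hAP hA
      refine ⟨g, hgm, hgi, hg, fun m q hq => hgint.trans ?_⟩
      have h1 := hb2 _ ⟨m, q, hq, rfl⟩
      nlinarith
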